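/- Let $1\le p<2$ and let $\{X_n,\ n\ge 1\}$ be a sequence of real random variables on a probability space for which there is a constant $C$ such that $$\operatorname{Var}\Big(\sum_{i=k+1}^{k+\ell} f_i(X_i)\Big)\le C\sum_{i=k+1}^{k+\ell}\operatorname{Var}\big(f_i(X_i)\big)$$ for all $k\ge 0$, $\ell\ge 1$ and all nondecreasing functions $f_i:\mathbb R\to\mathbb R$, $i\ge 1$, for which the variances of $f_i(X_i)$, $k+1\le i\le k+\ell$, exist (are finite). Let $L$ be a slowly varying function defined on $[0,\infty)$, that is, $L$ is positive and measurable on $[A,\infty)$ for some $A>0$ and $\lim_{x\to\infty}L(\lambda x)/L(x)=1$ for every $\lambda>0$. Assume that $L$ is continuous on $[0,\infty)$, differentiable on $[A,\infty)$ for some $A>0$, and satisfies $\lim_{x\to\infty}xL'(x)/L(x)=0$. If $p=1$, assume in addition that $L(x)\ge 1$ for all $x\ge 0$ and that $L$ is nondecreasing on $[0,\infty)$. Let $\tilde L$ be a de Bruijn conjugate of $L$, that is, a slowly varying function (unique up to asymptotic equivalence) with $$\lim_{x\to\infty}L(x)\,\tilde L\big(xL(x)\big)=1\quad\text{and}\quad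 \lim_{x\to\infty}\tilde L(x)\,L\big(x\tilde L(x)\big)=1 .$$ Suppose that $\{X_n,\ n\ge1\}$ is stochastically dominated by a random variable $X$ (possibly defined on another probability space), that is, $\sup_{n\ge 1}\mathbb P(|X_n|>t)\le \mathbb P(|X|>t)$ for all $t\ge 0$, and that $$\mathbb E\big(|X|^pL^p(|X|)\big)<\infty .$$ Then every $X_n$ is integrable and, for all $\alpha\ge 1/p$, $$\sum_{n=1}^{\infty} n^{\alpha p-2}\,\mathbb P\Big(\max_{1\le j\le n}\Big|\sum_{i=1}^{j}\big(X_i-\mathbb E(X_i)\big)\Big|>\varepsilon\, n^{\alpha}\tilde L(n^{\alpha})\Big)<\infty\qquad\text{for all }\varepsilon>0 .$$ -/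

import Mathlib

open MeasureTheory ProbabilityTheory Filter Topology Set
open scoped NNReal

/-- `R` is regularly varying (at infinity) with index `ρ`: it is positive and measurable on some
half-line `[A, ∞)` with `A > 0`, and `R (c x) / R x → c ^ ρ` as `x → ∞` for every `c > 0`. -/
def IsRegularlyVarying (ρ : ℝ) (R : ℝ → ℝ) : Prop :=
  (∃ A : ℝ, 0 < A ∧ (∀ x, A ≤ x → 0 < R x) ∧ Measurable fun x : Ici A => R x) ∧
    ∀ c : ℝ, 0 < c → Tendsto (fun x => R (c * x) / R x) atTop (𝓝 (c ^ ρ))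

/-- Slowly varying (at infinity): regularly varying with index `0`. -/
def IsSlowlyVarying (L : ℝ → ℝ) : Prop :=
  IsRegularlyVarying 0 L

/-- `Lt` is a de Bruijn conjugate of `L` (it is unique only up to asymptotic equivalence). -/
def IsDeBruijnConjugate (L Lt : ℝ → ℝ) : Prop :=
  IsSlowlyVarying Lt ∧
    Tendsto (fun x => L x * Lt (x * L x)) atTop (𝓝 1) ∧
    Tendsto (fun x => Lt x * L (x * Lt x)) atTop (𝓝 1)

/-- The sequence `X 1, X 2, …` satisfies the variance inequality: for one constant `C`, all blocks
`k + 1, …, k + ℓ` and all nondecreasing `f i` such that each `f i (X i)` in the block has a (finite)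
variance, `Var (∑ f i (X i)) ≤ C * ∑ Var (f i (X i))`. -/
def VarianceInequality {Ω : Type*} [MeasurableSpace Ω] (P : Measure Ω) (X : ℕ → Ω → ℝ) : Prop :=
  ∃ C : ℝ, ∀ k ℓ : ℕ, 1 ≤ ℓ → ∀ f : ℕ → ℝ → ℝ, (∀ i, 1 ≤ i → Monotone (f i)) →
    (∀ i ∈ Finset.Icc (k + 1) (k + ℓ), MemLp (fun ω => f i (X i ω)) 2 P) →
    variance (fun ω => ∑ i ∈ Finset.Icc (k + 1) (k + ℓ), f i (X i ω)) P ≤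
      C * ∑ i ∈ Finset.Icc (k + 1) (k + ℓ), variance (fun ω => f i (X i ω)) P

/-- The sequence `X 1, X 2, …` is stochastically dominated by the random variable `Y`, which may
live on another probability space. -/
def StochasticallyDominated {Ω Ω' : Type*} [MeasurableSpace Ω] [MeasurableSpace Ω']
    (P : Measure Ω) (X : ℕ → Ω → ℝ) (P' : Measure Ω') (Y : Ω' → ℝ) : Prop :=
  ∀ t : ℝ, 0 ≤ t → ∀ n : ℕ, 1 ≤ n → P {ω | t < |X n ω|} ≤ P' {ω | t < |Y ω|}

/-- `max_{1 ≤ j ≤ n} |∑_{i = 1}^j (X i - E (X i))|` (and `0` for `n = 0`). -/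
noncomputable def maxCenteredSum {Ω : Type*} [MeasurableSpace Ω] (P : Measure Ω)
    (X : ℕ → Ω → ℝ) (n : ℕ) (ω : Ω) : ℝ :=
  ((Finset.Icc 1 n).sup fun j => ‖∑ i ∈ Finset.Icc 1 j, (X i ω - ∫ ω', X i ω' ∂P)‖₊ : ℝ≥0)

/-! ### Dyadic chaining -/

/-! Choose levels `w m` with `w m * L (w m)` equal to a constant times `2 ^ (α * m)`. By de Bruijn
conjugacy, `w` at `Nat.log 2 n + 1` is at most a constant times `n ^ α * Lt (n ^ α)`. With `q = 2 ^
(α * p)`, the moment hypothesis gives `∑ q ^ m * P' (|Y| > w m) < ∞`. It therefore suffices to sum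
`(q / 2) ^ m * P (max_{j ≤ 2 ^ m} |S j| > ε * w m)`, where `S j` denotes the centered partial sums.
The ratios `w (m + 1) / w m` lie between `r = 2 ^ (α / s)` and `q`, where `s > 1` is chosen with `s
* p < 2`, so that `q < r ^ 2`.

The variance inequality controls blocks, not maxima. Dyadic chaining at the single truncation level
`w m` would lose logarithmic factors, as in Rademacher–Menshov. Here the truncation follows the
scale: blocks of length `2 ^ k` use truncation at `w k`. Passing from `w (k + 1)` to `w k` costs the
absolute increments of the truncation, summed over whole blocks of length `2 ^ (k + 1)`. The
positive and negative parts of an increment are both nondecreasing functions, so the variance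
inequality applies to them as well (`abs_sum_Ioc_le_chain`, `abs_sum_dev_clip_le`).

Weighted Cauchy–Schwarz over the scales and Markov's inequality then leave a geometric convolution
of truncated second moments, summable because `q < r ^ 2` (`summable_sum_truncSq`). The drifts from
the means are `o(w m)` (`tendsto_sum_increments`, `tendsto_tail`). -/

theorem abs_sum_Ioc_le_chain {ξ ζ : ℕ → ℕ → ℝ} {A B : ℕ → ℝ} {m : ℕ}
    (hζ : ∀ k i, 1 ≤ i → |ξ (k + 1) i - ξ k i| ≤ ζ k i)
    (hA : ∀ k b, (b + 1) * 2 ^ k ≤ 2 ^ m →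
      |∑ i ∈ Finset.Ioc (b * 2 ^ k) ((b + 1) * 2 ^ k), ξ k i| ≤ A k)
    (hB : ∀ k b, (b + 1) * 2 ^ (k + 1) ≤ 2 ^ m →
      ∑ i ∈ Finset.Ioc (b * 2 ^ (k + 1)) ((b + 1) * 2 ^ (k + 1)), ζ k i ≤ B k) (k : ℕ) :
    ∀ b, (b + 1) * 2 ^ k ≤ 2 ^ m → ∀ j ≤ 2 ^ k,
      |∑ i ∈ Finset.Ioc (b * 2 ^ k) (b * 2 ^ k + j), ξ k i| ≤
        A 0 + ∑ l ∈ Finset.range k, (A l + B l) := by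
  induction k with
  | zero =>
    intro b hb j hj
    have h0 := hA 0 b hb
    have : j = 0 ∨ j = 1 := by simp at hj; omega
    rcases this with rfl | rfl
    · simpa using (abs_nonneg _).trans h0
    · simpa [add_mul] using h0
  | succ k ih =>
    intro b hb j hj
    have hpow : 2 ^ (k + 1) = 2 * 2 ^ k := by ring
    have hζ0 : ∀ i ∈ Finset.Ioc (b * 2 ^ (k + 1)) ((b + 1) * 2 ^ (k + 1)), 0 ≤ ζ k i := by
      intro i hi
      exact (abs_nonneg _).trans (hζ k i (by simp at hi; omega))
    -- Since `ζ` is nonnegative, the cost of changing level on an initial segment is at most its sum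
    -- over the whole block, which no longer depends on `j`.
    have hdiff : |∑ i ∈ Finset.Ioc (b * 2 ^ (k + 1)) (b * 2 ^ (k + 1) + j), ξ (k + 1) i -
        ∑ i ∈ Finset.Ioc (b * 2 ^ (k + 1)) (b * 2 ^ (k + 1) + j), ξ k i| ≤ B k := by
      rw [← Finset.sum_sub_distrib]
      refine (Finset.abs_sum_le_sum_abs _ _).trans (le_trans ?_ (hB k b hb))
      refine (Finset.sum_le_sum fun i hi => hζ k i (by simp at hi; omega)).trans ?_
      refine Finset.sum_le_sum_of_subset_of_nonneg ?_ fun i hi _ => hζ0 i hi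
      exact Finset.Ioc_subset_Ioc_right (by rw [add_mul]; omega)
    have e0 : b * 2 ^ (k + 1) = 2 * b * 2 ^ k := by ring
    have h1 : (2 * b + 1) * 2 ^ k ≤ 2 ^ m := by nlinarith [Nat.zero_le (2 ^ k)]
    have h2 : (2 * b + 1 + 1) * 2 ^ k ≤ 2 ^ m := by nlinarith
    have hA0 := (abs_nonneg _).trans (hA k (2 * b) h1)
    have main : |∑ i ∈ Finset.Ioc (b * 2 ^ (k + 1)) (b * 2 ^ (k + 1) + j), ξ k i| ≤
        A k + (A 0 + ∑ l ∈ Finset.range k, (A l + B l)) := by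
      rw [e0]
      -- Past the midpoint, the first half is a complete block costing `A k`, and the rest is an
      -- initial segment of the second half.
      rcases le_total j (2 ^ k) with h | h
      · linarith [ih (2 * b) h1 j h]
      · obtain ⟨t, rfl⟩ := Nat.exists_eq_add_of_le h
        have e1 : (2 * b + 1) * 2 ^ k = 2 * b * 2 ^ k + 2 ^ k := by ring
        rw [← Finset.sum_Ioc_consecutive _ (n := (2 * b + 1) * 2 ^ k) (by omega) (by omega)]
        have h3 := ih (2 * b + 1) h2 t (by omega)
        have h4 := hA k (2 * b) h1
        rw [show 2 * b * 2 ^ k + (2 ^ k + t) = (2 * b + 1) * 2 ^ k + t by rw [e1]; ring]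
        exact (abs_add_le _ _).trans (add_le_add h4 h3)
    rw [Finset.sum_range_succ]
    have := abs_sub_abs_le_abs_sub
      (∑ i ∈ Finset.Ioc (b * 2 ^ (k + 1)) (b * 2 ^ (k + 1) + j), ξ (k + 1) i)
      (∑ i ∈ Finset.Ioc (b * 2 ^ (k + 1)) (b * 2 ^ (k + 1) + j), ξ k i)
    linarith

/-! ### Truncation -/

/-- Truncation of `x` to `[-a, a]`. -/
def clip (a x : ℝ) : ℝ := max (-a) (min x a)

theorem clip_monotone (a : ℝ) : Monotone (clip a) := fun _ _ h =>
  max_le_max le_rfl (min_le_min h le_rfl)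

theorem abs_clip_le {a : ℝ} (ha : 0 ≤ a) (x : ℝ) : |clip a x| ≤ a := by
  unfold clip; rw [abs_le]; constructor
  · exact le_max_left _ _
  · exact max_le (by linarith) (min_le_right _ _)

theorem clip_eq_self {a x : ℝ} (h : |x| ≤ a) : clip a x = x := by
  rw [abs_le] at h
  unfold clip; rw [min_eq_left h.2, max_eq_right h.1]

/-- This makes the increments, and hence their positive and negative parts, admissible in the
variance inequality. -/
theorem clip_sub_clip_monotone {a b : ℝ} (ha : 0 ≤ a) (hab : a ≤ b) :
    Monotone fun x => clip b x - clip a x := by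
  intro x y h
  simp only [clip]
  rcases le_total x a with h1 | h1 <;> rcases le_total x b with h2 | h2 <;>
  rcases le_total y a with h3 | h3 <;> rcases le_total y b with h4 | h4 <;>
  simp only [min_eq_left, min_eq_right, h1, h2, h3, h4] <;>
  simp only [max_def] <;> split_ifs <;> linarith

theorem abs_clip_sub_clip_le {a b : ℝ} (ha : 0 ≤ a) (hab : a ≤ b) (x : ℝ) :
    |clip b x - clip a x| ≤ {y : ℝ | a < |y|}.indicator (fun _ => b) x := by
  by_cases h : a < |x|
  · rw [indicator_of_mem (by exact h)]
    have h1 : clip a x ≤ clip b x ∧ 0 ≤ clip a x ∨ clip b x ≤ clip a x ∧ clip a x ≤ 0 := by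
      rcases le_total 0 x with hx | hx
      · left
        refine ⟨max_le ((neg_nonpos.2 ha).trans ?_) ?_, ?_⟩
        · exact le_max_of_le_right (le_min hx (ha.trans hab))
        · exact le_max_of_le_right (min_le_min le_rfl hab)
        · exact le_max_of_le_right (le_min hx ha)
      · right
        refine ⟨?_, max_le (by linarith) ((min_le_left _ _).trans hx)⟩
        unfold clip
        rw [min_eq_left (by linarith), min_eq_left (by linarith)]
        exact max_le_max (by linarith) le_rfl
    have h2 := abs_le.1 (abs_clip_le (ha.trans hab) x)
    rw [abs_le]
    rcases h1 with h1 | h1 <;> constructor <;> linarith [h1.1, h1.2]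
  · rw [indicator_of_notMem (by exact h), clip_eq_self (not_lt.1 h),
      clip_eq_self ((not_lt.1 h).trans hab)]
    simp

/-- Induction on the level: if `|x| ≤ w k`, raising the level changes nothing; otherwise the newest
term alone dominates the square. -/
theorem clip_sq_le {w : ℕ → ℝ} (hw : ∀ k, 0 < w k) (hmono : Monotone w) (k : ℕ) (x : ℝ) :
    clip (w k) x ^ 2 ≤ w 0 ^ 2 + ∑ l ∈ Finset.range k,
      w (l + 1) ^ 2 * {y : ℝ | w l < |y|}.indicator 1 x := by
  induction k with
  | zero =>
    have h1 := abs_le.1 (abs_clip_le (hw 0).le x)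
    simpa using sq_le_sq' h1.1 h1.2
  | succ k ih =>
    rw [Finset.sum_range_succ]
    by_cases h : w k < |x|
    · rw [indicator_of_mem (by exact h)]
      have h1 := abs_le.1 (abs_clip_le (hw (k + 1)).le x)
      have h2 := sq_le_sq' h1.1 h1.2
      have h3 : 0 ≤ ∑ l ∈ Finset.range k, w (l + 1) ^ 2 * {y : ℝ | w l < |y|}.indicator 1 x :=
        Finset.sum_nonneg fun l _ =>
          mul_nonneg (sq_nonneg _) (indicator_nonneg (fun _ _ => zero_le_one) _)
      have := sq_nonneg (w 0)
      simp only [Pi.one_apply]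
      linarith
    · rw [indicator_of_notMem (by exact h)]
      rw [clip_eq_self ((not_lt.1 h).trans (hmono k.le_succ))]
      rw [clip_eq_self (not_lt.1 h)] at ih
      linarith

/-! ### Geometrically growing levels -/

/-- `w` is a positive sequence whose successive ratios lie between `r > 1` and `q`, where
`2 ≤ q < r ^ 2`. -/
structure GeometricLevels (q r : ℝ) (w : ℕ → ℝ) : Prop where
  pos : ∀ k, 0 < w k
  le_succ : ∀ k, r * w k ≤ w (k + 1)
  succ_le : ∀ k, w (k + 1) ≤ q * w k
  one_lt : 1 < r
  two_le : 2 ≤ q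
  lt_sq : q < r ^ 2

namespace GeometricLevels

variable {q r : ℝ} {w : ℕ → ℝ}

theorem monotone (h : GeometricLevels q r w) : Monotone w :=
  monotone_nat_of_le_succ fun k => by nlinarith [h.le_succ k, h.pos k, h.one_lt]

theorem pow_mul_le (h : GeometricLevels q r w) (k j : ℕ) : r ^ j * w k ≤ w (k + j) := by
  induction j with
  | zero => simp
  | succ j ih =>
    have := h.le_succ (k + j)
    have := h.one_lt
    calc r ^ (j + 1) * w k = r * (r ^ j * w k) := by ring
      _ ≤ r * w (k + j) := by gcongr
      _ ≤ w (k + (j + 1)) := by simpa [add_assoc] using h.le_succ (k + j)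

theorem le_pow_mul (h : GeometricLevels q r w) (k j : ℕ) : w (k + j) ≤ q ^ j * w k := by
  induction j with
  | zero => simp
  | succ j ih =>
    have := h.two_le
    calc w (k + (j + 1)) ≤ q * w (k + j) := by simpa [add_assoc] using h.succ_le (k + j)
      _ ≤ q * (q ^ j * w k) := by gcongr
      _ = q ^ (j + 1) * w k := by ring

theorem tendsto_atTop (h : GeometricLevels q r w) : Tendsto w atTop atTop := by
  refine tendsto_atTop_mono (fun k => ?_)
    ((tendsto_pow_atTop_atTop_of_one_lt h.one_lt).atTop_mul_const (h.pos 0))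
  simpa using h.pow_mul_le 0 k

end GeometricLevels

theorem summable_sum_range_mul_pow {a : ℕ → ℝ} {θ : ℝ} (ha : Summable a)
    (h0 : 0 ≤ θ) (h1 : θ < 1) :
    Summable fun m : ℕ => ∑ k ∈ Finset.range (m + 1), a k * θ ^ (m - k) := by
  have := summable_norm_sum_mul_range_of_summable_norm (f := a) (g := fun n => θ ^ n)
    ha.norm (summable_geometric_of_lt_one h0 h1).norm
  exact this.of_norm

/-- The bound for the second moment of the truncation at level `k` of a variable whose tails at
the levels `w l` are at most `t l`. -/
def truncSq (w t : ℕ → ℝ) (k : ℕ) : ℝ :=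
  w 0 ^ 2 + ∑ l ∈ Finset.range k, w (l + 1) ^ 2 * t l

theorem truncSq_nonneg {w t : ℕ → ℝ} (ht : ∀ l, 0 ≤ t l) (k : ℕ) : 0 ≤ truncSq w t k :=
  add_nonneg (sq_nonneg _) (Finset.sum_nonneg fun l _ => mul_nonneg (sq_nonneg _) (ht l))

namespace GeometricLevels

variable {q r : ℝ} {w t : ℕ → ℝ}

/-- Each step multiplies `w ^ 2` by at least `r ^ 2` and the numerator by `q`; the geometric decay
behind all the second-moment series comes from here. -/
theorem pow_div_sq_le (h : GeometricLevels q r w) {k m : ℕ} (hkm : k ≤ m) :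
    q ^ m / w m ^ 2 ≤ q ^ k / w k ^ 2 * (q / r ^ 2) ^ (m - k) := by
  obtain ⟨j, rfl⟩ := Nat.exists_eq_add_of_le hkm
  have h1 := h.pow_mul_le k j
  have hq := h.two_le
  have hr := h.one_lt
  have hk := h.pos k
  have : (r ^ j * w k) ^ 2 ≤ w (k + j) ^ 2 := by gcongr
  calc q ^ (k + j) / w (k + j) ^ 2 ≤ q ^ (k + j) / (r ^ j * w k) ^ 2 := by gcongr
    _ = _ := by
      rw [Nat.add_sub_cancel_left, div_pow]
      field_simp
      ring

/-- Inserting the definition of `truncSq` gives a convolution of the summable sequence `q ^ l * t l`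
with powers of `q / r ^ 2 < 1`. -/
theorem summable_truncSq (h : GeometricLevels q r w) (ht : ∀ l, 0 ≤ t l)
    (hs : Summable fun l => q ^ l * t l) :
    Summable fun k => q ^ k / w k ^ 2 * truncSq w t k := by
  have hq := h.two_le
  have hr := h.one_lt
  have hθ : q / r ^ 2 < 1 := (div_lt_one (by positivity)).2 h.lt_sq
  have hθ0 : 0 ≤ q / r ^ 2 := by positivity
  have hconv := summable_sum_range_mul_pow (hs.mul_left q) hθ0 hθ
  rw [← summable_nat_add_iff 1]
  refine Summable.of_nonneg_of_le (fun k => ?_) (fun k => ?_)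
    (((summable_nat_add_iff 1).2 (summable_geometric_of_lt_one hθ0 hθ)).add hconv)
  · have := truncSq_nonneg ht (k + 1) (w := w)
    positivity
  · rw [truncSq, mul_add]
    refine add_le_add ?_ ?_
    · have h1 := h.pow_div_sq_le (Nat.zero_le (k + 1))
      have h0 := h.pos 0
      calc _ ≤ q ^ 0 / w 0 ^ 2 * (q / r ^ 2) ^ (k + 1 - 0) * w 0 ^ 2 := by gcongr
        _ = _ := by simp; field_simp
    · rw [Finset.mul_sum]
      refine Finset.sum_le_sum fun l hl => ?_
      have hl' : l + 1 ≤ k + 1 := by simp at hl; omega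
      have h1 := h.pow_div_sq_le hl'
      have h0 := h.pos (l + 1)
      have := ht l
      calc _ ≤ q ^ (l + 1) / w (l + 1) ^ 2 * (q / r ^ 2) ^ (k + 1 - (l + 1)) *
            (w (l + 1) ^ 2 * t l) := by gcongr
        _ = _ := by
          rw [Nat.add_sub_add_right]
          field_simp
          ring

/-- The factors `σ ^ (m - k)` come from the weighted Cauchy–Schwarz inequality; they only worsen the
convolution ratio to `σ * q / r ^ 2`, still below 1. -/
theorem summable_sum_truncSq (h : GeometricLevels q r w) (ht : ∀ l, 0 ≤ t l)
    (hs : Summable fun l => q ^ l * t l) {σ : ℝ} (hσ : 1 < σ) (hσr : σ * q < r ^ 2) :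
    Summable fun m => q ^ m / w m ^ 2 *
      ∑ k ∈ Finset.range m, σ ^ (m - k) * truncSq w t (k + 1) := by
  have hq := h.two_le
  have hr := h.one_lt
  have hθ : σ * q / r ^ 2 < 1 := (div_lt_one (by positivity)).2 hσr
  have hθ0 : 0 ≤ σ * q / r ^ 2 := by positivity
  have hconv := summable_sum_range_mul_pow
    ((summable_nat_add_iff 1).2 (h.summable_truncSq ht hs)) hθ0 hθ
  rw [← summable_nat_add_iff 1]
  refine Summable.of_nonneg_of_le (fun m => ?_) (fun m => ?_) (hconv.mul_left σ)
  · refine mul_nonneg (by positivity) (Finset.sum_nonneg fun k _ => ?_)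
    have := truncSq_nonneg ht (k + 1) (w := w)
    positivity
  · rw [Finset.mul_sum, Finset.mul_sum]
    refine Finset.sum_le_sum fun k hk => ?_
    have hk' : k + 1 ≤ m + 1 := by simp at hk; omega
    have h1 := h.pow_div_sq_le hk'
    have := truncSq_nonneg ht (k + 1) (w := w)
    calc _ ≤ q ^ (k + 1) / w (k + 1) ^ 2 * (q / r ^ 2) ^ (m + 1 - (k + 1)) *
          (σ ^ (m + 1 - k) * truncSq w t (k + 1)) := by gcongr
      _ = _ := by
        rw [Nat.add_sub_add_right, show m + 1 - k = m - k + 1 by omega, mul_div_assoc, mul_pow]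
        ring

/-- Since `2 ≤ q`, `w (k + 1) ≤ q * w k` and `r ^ (m - k) * w k ≤ w m`, the quotient is at most a
convolution of `q ^ k * t k` with powers of `r⁻¹`. -/
theorem tendsto_sum_increments (h : GeometricLevels q r w) (ht : ∀ l, 0 ≤ t l)
    (hs : Summable fun l => q ^ l * t l) :
    Tendsto (fun m => (∑ k ∈ Finset.range m, 4 * (2 ^ k * (w (k + 1) * t k))) / w m)
      atTop (𝓝 0) := by
  have hq := h.two_le
  have hr := h.one_lt
  have hconv := (summable_sum_range_mul_pow (θ := r⁻¹) (hs.mul_left (4 * q))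
    (by positivity) (inv_lt_one_of_one_lt₀ hr)).tendsto_atTop_zero
  refine squeeze_zero (fun m => ?_) (fun m => ?_) hconv
  · refine div_nonneg (Finset.sum_nonneg fun k _ => ?_) (h.pos m).le
    have := ht k
    have := h.pos (k + 1)
    positivity
  · rw [Finset.sum_range_succ, Finset.sum_div]
    have h0 : 0 ≤ 4 * q * (q ^ m * t m) * r⁻¹ ^ (m - m) := by
      have := ht m
      positivity
    refine le_trans (Finset.sum_le_sum fun k hk => ?_) (le_add_of_nonneg_right h0)
    obtain ⟨j, rfl⟩ := Nat.exists_eq_add_of_le (Finset.mem_range.1 hk).le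
    rw [Nat.add_sub_cancel_left, div_le_iff₀ (h.pos _)]
    have h1 := h.succ_le k
    have h2 := h.pow_mul_le k j
    have h3 := ht k
    have h4 := h.pos k
    have h5 := mul_nonneg (h.pos (k + 1)).le h3
    calc 4 * (2 ^ k * (w (k + 1) * t k)) ≤ 4 * (q ^ k * (q * w k * t k)) := by gcongr
      _ = 4 * q * (q ^ k * t k) * r⁻¹ ^ j * (r ^ j * w k) := by
        rw [inv_pow]; field_simp
      _ ≤ _ := by gcongr

theorem summable_tail (h : GeometricLevels q r w) (ht : ∀ l, 0 ≤ t l)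
    (hs : Summable fun l => q ^ l * t l) (m : ℕ) :
    Summable fun l => w (l + m + 1) * t (l + m) := by
  have hq := h.two_le
  refine Summable.of_nonneg_of_le (fun l => mul_nonneg (h.pos _).le (ht _)) (fun l => ?_)
    (((summable_nat_add_iff m).2 hs).mul_left (q * w 0))
  have h1 := h.le_pow_mul 0 (l + m + 1)
  have h2 := ht (l + m)
  rw [zero_add] at h1
  calc _ ≤ q ^ (l + m + 1) * w 0 * t (l + m) := by gcongr
    _ = _ := by ring

/-- After the crude bounds `2 ≤ q` and `w (l + m + 1) ≤ q ^ (l + 1) * w m`, this is `q` times a tail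
of `∑ q ^ l * t l`. -/
theorem tendsto_tail (h : GeometricLevels q r w) (ht : ∀ l, 0 ≤ t l)
    (hs : Summable fun l => q ^ l * t l) :
    Tendsto (fun m => 2 ^ m * (∑' l, w (l + m + 1) * t (l + m)) / w m) atTop (𝓝 0) := by
  have hq := h.two_le
  have h0 := (tendsto_sum_nat_add fun l => q ^ l * t l).const_mul q
  rw [mul_zero] at h0
  refine squeeze_zero (fun m => ?_) (fun m => ?_) h0
  · refine div_nonneg (mul_nonneg (by positivity) (tsum_nonneg fun l => ?_)) (h.pos m).le
    exact mul_nonneg (h.pos _).le (ht _)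
  · rw [div_le_iff₀ (h.pos m), ← tsum_mul_left, ← tsum_mul_left, ← tsum_mul_right]
    refine Summable.tsum_le_tsum (fun l => ?_) ((h.summable_tail ht hs m).mul_left _)
      ((((summable_nat_add_iff m).2 hs).mul_left q).mul_right _)
    have h1 := h.le_pow_mul m (l + 1)
    have h2 := ht (l + m)
    have h3 := h.pos m
    have h4 := mul_nonneg (h.pos (l + m + 1)).le h2
    rw [show m + (l + 1) = l + m + 1 by ring] at h1
    calc _ ≤ q ^ m * (q ^ (l + 1) * w m * t (l + m)) := by gcongr
      _ = _ := by ring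

end GeometricLevels

/-! ### Moments of truncations -/

/-- The positive part of the increment between the truncations at `w k` and `w (k + 1)`. -/
def clipUp (w : ℕ → ℝ) (k : ℕ) (x : ℝ) : ℝ := max (clip (w (k + 1)) x - clip (w k) x) 0

/-- The negative part of the increment between the truncations at `w k` and `w (k + 1)`. -/
def clipDown (w : ℕ → ℝ) (k : ℕ) (x : ℝ) : ℝ := min (clip (w (k + 1)) x - clip (w k) x) 0

theorem clipUp_add_clipDown (w : ℕ → ℝ) (k : ℕ) (x : ℝ) :
    clipUp w k x + clipDown w k x = clip (w (k + 1)) x - clip (w k) x := by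
  rw [clipUp, clipDown, max_add_min, add_zero]

theorem clipUp_nonneg (w : ℕ → ℝ) (k : ℕ) (x : ℝ) : 0 ≤ clipUp w k x := le_max_right _ _

theorem clipDown_nonpos (w : ℕ → ℝ) (k : ℕ) (x : ℝ) : clipDown w k x ≤ 0 := min_le_right _ _

theorem abs_clipUp_le (w : ℕ → ℝ) (k : ℕ) (x : ℝ) :
    |clipUp w k x| ≤ |clip (w (k + 1)) x - clip (w k) x| := by
  rw [abs_of_nonneg (clipUp_nonneg w k x)]
  exact max_le (le_abs_self _) (abs_nonneg _)

theorem abs_clipDown_le (w : ℕ → ℝ) (k : ℕ) (x : ℝ) :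
    |clipDown w k x| ≤ |clip (w (k + 1)) x - clip (w k) x| := by
  rw [abs_of_nonpos (clipDown_nonpos w k x), neg_le]
  exact le_min (neg_abs_le _) (neg_nonpos.2 (abs_nonneg _))

theorem clipUp_sub_clipDown (w : ℕ → ℝ) (k : ℕ) (x : ℝ) :
    clipUp w k x - clipDown w k x = |clip (w (k + 1)) x - clip (w k) x| := by
  rw [clipUp, clipDown, max_sub_min_eq_abs', sub_zero]

section Moments

variable {Ω : Type*} [MeasurableSpace Ω] {P : Measure Ω} [IsProbabilityMeasure P]
  {q r : ℝ} {w t : ℕ → ℝ} {Z : Ω → ℝ}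

theorem integrable_comp_of_monotone {φ : ℝ → ℝ} (hφ : Monotone φ) {M : ℝ} (hM : ∀ x, |φ x| ≤ M)
    (hZ : Measurable Z) : Integrable (fun ω => φ (Z ω)) P :=
  Integrable.of_bound (hφ.measurable.comp hZ).aestronglyMeasurable M
    (Eventually.of_forall fun _ => hM _)

theorem memLp_comp_of_monotone {φ : ℝ → ℝ} (hφ : Monotone φ) {M : ℝ} (hM : ∀ x, |φ x| ≤ M)
    (hZ : Measurable Z) : MemLp (fun ω => φ (Z ω)) 2 P :=
  MemLp.of_bound (hφ.measurable.comp hZ).aestronglyMeasurable M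
    (Eventually.of_forall fun _ => hM _)

theorem measurableSet_lt_abs (hZ : Measurable Z) (a : ℝ) : MeasurableSet {ω | a < |Z ω|} :=
  measurableSet_lt measurable_const (_root_.continuous_abs.measurable.comp hZ)

theorem integrable_indicator_abs (hZ : Measurable Z) (a b : ℝ) :
    Integrable (fun ω => {y : ℝ | a < |y|}.indicator (fun _ => b) (Z ω)) P :=
  (integrable_const b).indicator (measurableSet_lt_abs hZ a)

omit [IsProbabilityMeasure P] in
theorem integral_indicator_abs (hZ : Measurable Z) (a b : ℝ) :
    ∫ ω, {y : ℝ | a < |y|}.indicator (fun _ => b) (Z ω) ∂P = P.real {ω | a < |Z ω|} * b :=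
  integral_indicator_const b (measurableSet_lt_abs hZ a)

theorem integral_clip_sq_le (h : GeometricLevels q r w) (hZ : Measurable Z)
    (ht : ∀ l, P.real {ω | w l < |Z ω|} ≤ t l) (k : ℕ) :
    ∫ ω, clip (w k) (Z ω) ^ 2 ∂P ≤ truncSq w t k := by
  have hint : ∀ l ∈ Finset.range k, Integrable (fun ω =>
      w (l + 1) ^ 2 * {y : ℝ | w l < |y|}.indicator 1 (Z ω)) P := fun l _ =>
    (integrable_indicator_abs hZ (w l) 1).const_mul _
  calc ∫ ω, clip (w k) (Z ω) ^ 2 ∂P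
      ≤ ∫ ω, (w 0 ^ 2 + ∑ l ∈ Finset.range k,
          w (l + 1) ^ 2 * {y : ℝ | w l < |y|}.indicator 1 (Z ω)) ∂P := by
        refine integral_mono
          (memLp_comp_of_monotone (clip_monotone _) (abs_clip_le (h.pos k).le) hZ).integrable_sq
          ((integrable_const _).add (integrable_finsetSum _ hint))
          fun ω => clip_sq_le h.pos h.monotone k (Z ω)
    _ = w 0 ^ 2 + ∑ l ∈ Finset.range k, w (l + 1) ^ 2 * P.real {ω | w l < |Z ω|} := by
        rw [integral_add (integrable_const _) (integrable_finsetSum _ hint),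
          integral_finsetSum _ hint]
        simp only [integral_const, probReal_univ, one_smul]
        congr 1
        refine Finset.sum_congr rfl fun l _ => ?_
        rw [integral_const_mul]
        have := integral_indicator_abs (P := P) hZ (w l) 1
        rw [mul_one] at this
        rw [← this]
        rfl
    _ ≤ _ := by
        rw [truncSq]
        gcongr with l
        exact ht l

theorem integral_abs_clip_sub_clip_le (h : GeometricLevels q r w) (hZ : Measurable Z)
    (ht : ∀ l, P.real {ω | w l < |Z ω|} ≤ t l) (k : ℕ) :
    ∫ ω, |clip (w (k + 1)) (Z ω) - clip (w k) (Z ω)| ∂P ≤ w (k + 1) * t k := by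
  have hk := h.monotone k.le_succ
  have hb := fun x => abs_clip_sub_clip_le (h.pos k).le hk x
  have hpos := (h.pos (k + 1)).le
  calc _ ≤ ∫ ω, {y : ℝ | w k < |y|}.indicator (fun _ => w (k + 1)) (Z ω) ∂P := by
        refine integral_mono ?_ (integrable_indicator_abs hZ _ _) fun ω => hb _
        exact (integrable_comp_of_monotone (clip_sub_clip_monotone (h.pos k).le hk)
          (fun x => (hb x).trans (indicator_le_self' (fun _ _ => hpos) x)) hZ).abs
    _ = P.real {ω | w k < |Z ω|} * w (k + 1) := integral_indicator_abs hZ _ _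
    _ ≤ t k * w (k + 1) := by gcongr; exact ht k
    _ = _ := mul_comm _ _

theorem integral_sq_le_truncSq_succ (h : GeometricLevels q r w) (hZ : Measurable Z)
    (ht : ∀ l, P.real {ω | w l < |Z ω|} ≤ t l) {k : ℕ} {φ : ℝ → ℝ} (hφ : Monotone φ)
    (hle : ∀ x, |φ x| ≤ |clip (w (k + 1)) x - clip (w k) x|) :
    ∫ ω, φ (Z ω) ^ 2 ∂P ≤ truncSq w t (k + 1) := by
  have hk := h.monotone k.le_succ
  have hb := fun x => (hle x).trans (abs_clip_sub_clip_le (h.pos k).le hk x)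
  have hpos := (h.pos (k + 1)).le
  have ht0 : ∀ l, 0 ≤ t l := fun l => measureReal_nonneg.trans (ht l)
  calc _ ≤ ∫ ω, {y : ℝ | w k < |y|}.indicator (fun _ => w (k + 1) ^ 2) (Z ω) ∂P := by
        refine integral_mono (memLp_comp_of_monotone hφ (fun x => (hb x).trans
          (indicator_le_self' (fun _ _ => hpos) x)) hZ).integrable_sq
          (integrable_indicator_abs hZ _ _) fun ω => ?_
        have h1 := hb (Z ω)
        simp only [indicator] at h1 ⊢
        split_ifs at h1 ⊢
        · exact sq_le_sq' (abs_le.1 h1).1 (abs_le.1 h1).2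
        · rw [abs_nonpos_iff.1 h1]; simp
    _ = P.real {ω | w k < |Z ω|} * w (k + 1) ^ 2 := integral_indicator_abs hZ _ _
    _ ≤ t k * w (k + 1) ^ 2 := by gcongr; exact ht k
    _ ≤ _ := by
        rw [truncSq, Finset.sum_range_succ]
        have : 0 ≤ ∑ l ∈ Finset.range k, w (l + 1) ^ 2 * t l :=
          Finset.sum_nonneg fun l _ => mul_nonneg (sq_nonneg _) (ht0 l)
        nlinarith [sq_nonneg (w 0)]

/-- Decompose according to the layer between consecutive levels that contains `|Z|`. The bound is
stated as a lower integral because it is what proves integrability of `Z`. -/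
theorem lintegral_sub_clip_le (h : GeometricLevels q r w) (hZ : Measurable Z)
    (ht : ∀ l, P.real {ω | w l < |Z ω|} ≤ t l) (hs : Summable fun l => q ^ l * t l) (m : ℕ) :
    ∫⁻ ω, ‖Z ω - clip (w m) (Z ω)‖ₑ ∂P ≤
      ENNReal.ofReal (∑' l, w (l + m + 1) * t (l + m)) := by
  have ht0 : ∀ l, 0 ≤ t l := fun l => measureReal_nonneg.trans (ht l)
  have hpt : ∀ x : ℝ, ‖x - clip (w m) x‖ₑ ≤
      ∑' l, {y : ℝ | w (l + m) < |y|}.indicator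
        (fun _ => ENNReal.ofReal (w (l + m + 1))) x := by
    intro x
    by_cases hx : |x| ≤ w m
    · simp [clip_eq_self hx]
    · push Not at hx
      have hex : ∃ l, |x| ≤ w (l + m + 1) := by
        obtain ⟨n, hn⟩ := (h.tendsto_atTop.eventually_ge_atTop |x|).exists
        exact ⟨n, hn.trans (h.monotone (by omega))⟩
      classical
      have hl := Nat.find_spec hex
      have hlt : w (Nat.find hex + m) < |x| := by
        rcases Nat.eq_zero_or_pos (Nat.find hex) with h0 | h0
        · rw [h0, zero_add]; exact hx
        · have := Nat.find_min hex (Nat.sub_lt h0 one_pos)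
          rw [show Nat.find hex - 1 + m + 1 = Nat.find hex + m by omega] at this
          exact not_le.1 this
      refine le_trans ?_ (ENNReal.le_tsum (Nat.find hex))
      rw [indicator_of_mem (by exact hlt), Real.enorm_eq_ofReal_abs]
      refine ENNReal.ofReal_le_ofReal ?_
      have h1 := abs_clip_sub_clip_le (h.pos m).le
        (h.monotone (show m ≤ Nat.find hex + m + 1 by omega)) x
      rw [clip_eq_self hl] at h1
      exact h1.trans (indicator_le_self' (fun _ _ => (h.pos _).le) x)
  calc _ ≤ ∫⁻ ω, ∑' l, {y : ℝ | w (l + m) < |y|}.indicator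
        (fun _ => ENNReal.ofReal (w (l + m + 1))) (Z ω) ∂P := lintegral_mono fun ω => hpt _
    _ = ∑' l, ENNReal.ofReal (w (l + m + 1)) * P {ω | w (l + m) < |Z ω|} := by
        rw [lintegral_tsum]
        · refine tsum_congr fun l => ?_
          exact lintegral_indicator_const (measurableSet_lt_abs hZ (w (l + m))) _
        · intro l
          exact (measurable_const.indicator (measurableSet_lt_abs hZ (w (l + m)))).aemeasurable
    _ ≤ ∑' l, ENNReal.ofReal (w (l + m + 1) * t (l + m)) := by
        refine ENNReal.tsum_le_tsum fun l => ?_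
        rw [ENNReal.ofReal_mul (h.pos _).le]
        gcongr
        rw [← ofReal_measureReal]
        exact ENNReal.ofReal_le_ofReal (ht _)
    _ = _ := (ENNReal.ofReal_tsum_of_nonneg (fun l => mul_nonneg (h.pos _).le (ht0 _))
        (h.summable_tail ht0 hs m)).symm

theorem integrable_of_tail_levels (h : GeometricLevels q r w) (hZ : Measurable Z)
    (ht : ∀ l, P.real {ω | w l < |Z ω|} ≤ t l) (hs : Summable fun l => q ^ l * t l) :
    Integrable Z P := by
  have hc : Integrable (fun ω => clip (w 0) (Z ω)) P :=
    integrable_comp_of_monotone (clip_monotone _) (abs_clip_le (h.pos 0).le) hZ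
  have hd : Integrable (fun ω => Z ω - clip (w 0) (Z ω)) P :=
    ⟨(hZ.sub ((clip_monotone _).measurable.comp hZ)).aestronglyMeasurable,
      (lintegral_sub_clip_le h hZ ht hs 0).trans_lt ENNReal.ofReal_lt_top⟩
  exact (hd.add hc).congr (Eventually.of_forall fun ω => sub_add_cancel _ _)

theorem abs_integral_sub_integral_clip_le (h : GeometricLevels q r w) (hZ : Measurable Z)
    (ht : ∀ l, P.real {ω | w l < |Z ω|} ≤ t l) (hs : Summable fun l => q ^ l * t l) (m : ℕ) :
    |∫ ω, Z ω ∂P - ∫ ω, clip (w m) (Z ω) ∂P| ≤ ∑' l, w (l + m + 1) * t (l + m) := by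
  have ht0 : ∀ l, 0 ≤ t l := fun l => measureReal_nonneg.trans (ht l)
  rw [← integral_sub (integrable_of_tail_levels h hZ ht hs)
    (integrable_comp_of_monotone (clip_monotone _) (abs_clip_le (h.pos m).le) hZ)]
  refine (norm_integral_le_lintegral_norm (fun ω => Z ω - clip (w m) (Z ω))).trans
    (ENNReal.toReal_le_of_le_ofReal (tsum_nonneg fun l => mul_nonneg (h.pos _).le (ht0 _)) ?_)
  simpa only [ofReal_norm] using lintegral_sub_clip_le h hZ ht hs m

end Moments

/-! ### Sums of squares of centered block sums -/

section Blocks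

variable {Ω : Type*} [MeasurableSpace Ω] {P : Measure Ω} {X : ℕ → Ω → ℝ}

/-- The centered variable `φ (X i) - E (φ (X i))`. -/
noncomputable def dev (P : Measure Ω) (X : ℕ → Ω → ℝ) (φ : ℝ → ℝ) (i : ℕ) (ω : Ω) : ℝ :=
  φ (X i ω) - ∫ ω', φ (X i ω') ∂P

/-- The sum of the squares of the centered sums over the dyadic blocks of length `2 ^ k` in
`(0, 2 ^ m]`. -/
noncomputable def blockSq (P : Measure Ω) (X : ℕ → Ω → ℝ) (m k : ℕ) (φ : ℝ → ℝ) (ω : Ω) : ℝ :=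
  ∑ b ∈ Finset.range (2 ^ (m - k)),
    (∑ i ∈ Finset.Ioc (b * 2 ^ k) ((b + 1) * 2 ^ k), dev P X φ i ω) ^ 2

theorem blockSq_nonneg (m k : ℕ) (φ : ℝ → ℝ) (ω : Ω) : 0 ≤ blockSq P X m k φ ω :=
  Finset.sum_nonneg fun _ _ => sq_nonneg _

/-- The maximum over the blocks of one scale is replaced by their `ℓ²` norm, whose second moment the
variance inequality controls. -/
theorem abs_sum_dev_le_sqrt_blockSq {m k b : ℕ} (hb : (b + 1) * 2 ^ k ≤ 2 ^ m) (φ : ℝ → ℝ)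
    (ω : Ω) : |∑ i ∈ Finset.Ioc (b * 2 ^ k) ((b + 1) * 2 ^ k), dev P X φ i ω| ≤
      √(blockSq P X m k φ ω) := by
  refine Real.abs_le_sqrt ?_
  have hk : k ≤ m := by
    by_contra hk
    have : 2 ^ m < 2 ^ k := Nat.pow_lt_pow_right one_lt_two (not_le.1 hk)
    exact absurd hb (not_le.2 (this.trans_le (Nat.le_mul_of_pos_left _ b.succ_pos)))
  have hmem : b ∈ Finset.range (2 ^ (m - k)) := by
    rw [Finset.mem_range]
    have : 2 ^ m = 2 ^ (m - k) * 2 ^ k := by rw [← pow_add]; congr 1; omega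
    rw [this] at hb
    exact Nat.lt_of_succ_le (Nat.le_of_mul_le_mul_right hb (by positivity))
  exact Finset.single_le_sum (f := fun b =>
    (∑ i ∈ Finset.Ioc (b * 2 ^ k) ((b + 1) * 2 ^ k), dev P X φ i ω) ^ 2)
    (fun _ _ => sq_nonneg _) hmem

variable [IsProbabilityMeasure P]

/-- There are `2 ^ (m - k)` blocks, each contributing at most `|C| * 2 ^ k * v`, so the total does
not depend on the scale `k`. -/
theorem integral_blockSq_le {C : ℝ} (hC : ∀ k ℓ : ℕ, 1 ≤ ℓ → ∀ f : ℕ → ℝ → ℝ,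
      (∀ i, 1 ≤ i → Monotone (f i)) →
      (∀ i ∈ Finset.Icc (k + 1) (k + ℓ), MemLp (fun ω => f i (X i ω)) 2 P) →
      variance (fun ω => ∑ i ∈ Finset.Icc (k + 1) (k + ℓ), f i (X i ω)) P ≤
        C * ∑ i ∈ Finset.Icc (k + 1) (k + ℓ), variance (fun ω => f i (X i ω)) P)
    (hX : ∀ n, 1 ≤ n → Measurable (X n)) {φ : ℝ → ℝ} (hφ : Monotone φ) {M v : ℝ}
    (hM : ∀ x, |φ x| ≤ M) (hv : ∀ i, 1 ≤ i → ∫ ω, φ (X i ω) ^ 2 ∂P ≤ v) {k m : ℕ} (hk : k ≤ m) :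
    Integrable (blockSq P X m k φ) P ∧ ∫ ω, blockSq P X m k φ ω ∂P ≤ |C| * 2 ^ m * v := by
  have hLp : ∀ i, 1 ≤ i → MemLp (fun ω => φ (X i ω)) 2 P := fun i hi =>
    memLp_comp_of_monotone hφ hM (hX i hi)
  have hdevLp : ∀ i, 1 ≤ i → MemLp (dev P X φ i) 2 P := fun i hi =>
    (hLp i hi).sub (memLp_const _)
  have hsumLp : ∀ b, MemLp (fun ω =>
      ∑ i ∈ Finset.Ioc (b * 2 ^ k) ((b + 1) * 2 ^ k), dev P X φ i ω) 2 P := fun b =>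
    memLp_finsetSum _ fun i hi => hdevLp i (by simp at hi; omega)
  have hint : ∀ b ∈ Finset.range (2 ^ (m - k)), Integrable (fun ω =>
      (∑ i ∈ Finset.Ioc (b * 2 ^ k) ((b + 1) * 2 ^ k), dev P X φ i ω) ^ 2) P := fun b _ =>
    (hsumLp b).integrable_sq
  refine ⟨integrable_finsetSum _ hint, ?_⟩
  have hblock : ∀ b, ∫ ω, (∑ i ∈ Finset.Ioc (b * 2 ^ k) ((b + 1) * 2 ^ k), dev P X φ i ω) ^ 2 ∂P
      ≤ |C| * (2 ^ k * v) := by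
    intro b
    have hset : Finset.Icc (b * 2 ^ k + 1) (b * 2 ^ k + 2 ^ k) =
        Finset.Ioc (b * 2 ^ k) ((b + 1) * 2 ^ k) := by
      ext i; simp only [Finset.mem_Icc, Finset.mem_Ioc, add_mul, one_mul]; omega
    have h1 := hC (b * 2 ^ k) (2 ^ k) Nat.one_le_two_pow (fun _ => φ) (fun _ _ => hφ)
      (fun i hi => hLp i (by simp at hi; omega))
    simp only [hset] at h1
    have hvar : variance (fun ω => ∑ i ∈ Finset.Ioc (b * 2 ^ k) ((b + 1) * 2 ^ k), φ (X i ω)) P =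
        ∫ ω, (∑ i ∈ Finset.Ioc (b * 2 ^ k) ((b + 1) * 2 ^ k), dev P X φ i ω) ^ 2 ∂P := by
      rw [variance_eq_integral]
      · rw [integral_finsetSum _ fun i hi =>
          (hLp i (by simp at hi; omega)).integrable one_le_two]
        simp only [dev, Finset.sum_sub_distrib]
      · exact (memLp_finsetSum _ fun i hi =>
          hLp i (by simp at hi; omega)).aestronglyMeasurable.aemeasurable
    rw [hvar] at h1
    refine h1.trans ?_
    have hnn : 0 ≤ ∑ i ∈ Finset.Ioc (b * 2 ^ k) ((b + 1) * 2 ^ k),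
        variance (fun ω => φ (X i ω)) P := Finset.sum_nonneg fun _ _ => variance_nonneg _ _
    refine (mul_le_mul_of_nonneg_right (le_abs_self C) hnn).trans ?_
    gcongr
    have hcard : (Finset.Ioc (b * 2 ^ k) ((b + 1) * 2 ^ k)).card = 2 ^ k := by
      rw [Nat.card_Ioc, add_mul, one_mul, Nat.add_sub_cancel_left]
    calc _ ≤ ∑ i ∈ Finset.Ioc (b * 2 ^ k) ((b + 1) * 2 ^ k), v := by
          refine Finset.sum_le_sum fun i hi => ?_
          have hi1 : 1 ≤ i := by simp at hi; omega
          exact (variance_le_expectation_sq (hLp i hi1).aestronglyMeasurable).trans (hv i hi1)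
      _ = 2 ^ k * v := by simp [hcard]
  unfold blockSq
  rw [integral_finsetSum _ hint]
  calc _ ≤ ∑ b ∈ Finset.range (2 ^ (m - k)), |C| * (2 ^ k * v) :=
        Finset.sum_le_sum fun b _ => hblock b
    _ = |C| * (2 ^ (m - k) * 2 ^ k) * v := by simp; ring
    _ = _ := by rw [← pow_add, Nat.sub_add_cancel hk]

end Blocks

/-! ### The maximal inequality along dyadic indices -/

theorem lt_maxCenteredSum_iff {Ω : Type*} [MeasurableSpace Ω] (P : Measure Ω) (X : ℕ → Ω → ℝ)
    {a : ℝ} (ha : 0 ≤ a) (n : ℕ) (ω : Ω) : a < maxCenteredSum P X n ω ↔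
      ∃ j ∈ Finset.Icc 1 n, a < |∑ i ∈ Finset.Icc 1 j, (X i ω - ∫ ω', X i ω' ∂P)| := by
  lift a to ℝ≥0 using ha
  rw [maxCenteredSum, NNReal.coe_lt_coe, Finset.lt_sup_iff]
  simp only [← NNReal.coe_lt_coe, coe_nnnorm, Real.norm_eq_abs]

theorem maxCenteredSum_monotone {Ω : Type*} [MeasurableSpace Ω] (P : Measure Ω) (X : ℕ → Ω → ℝ)
    (ω : Ω) : Monotone fun n => maxCenteredSum P X n ω := fun _ _ h =>
  NNReal.coe_le_coe.2 (Finset.sup_mono (Finset.Icc_subset_Icc_right h))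

theorem sqrt_add_sqrt_add_sqrt_le {a b c : ℝ} (ha : 0 ≤ a) (hb : 0 ≤ b) (hc : 0 ≤ c) :
    √a + (√b + √c) ≤ 3 * √(a + b + c) := by
  have h1 : √a ≤ √(a + b + c) := Real.sqrt_le_sqrt (by linarith)
  have h2 : √b ≤ √(a + b + c) := Real.sqrt_le_sqrt (by linarith)
  have h3 : √c ≤ √(a + b + c) := Real.sqrt_le_sqrt (by linarith)
  linarith

theorem sum_range_inv_pow_le {σ : ℝ} (hσ : 1 < σ) (m : ℕ) :
    ∑ k ∈ Finset.range m, σ⁻¹ ^ (m - k) ≤ 1 / (σ - 1) := by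
  have h0 : 0 < σ - 1 := sub_pos.2 hσ
  have h1 : 0 < σ := by linarith
  suffices h : ∑ k ∈ Finset.range m, σ⁻¹ ^ (m - k) = (1 - σ⁻¹ ^ m) / (σ - 1) by
    rw [h]
    gcongr
    have : 0 ≤ σ⁻¹ ^ m := by positivity
    linarith
  induction m with
  | zero => simp
  | succ m ih =>
    rw [Finset.sum_range_succ]
    have : ∑ k ∈ Finset.range m, σ⁻¹ ^ (m + 1 - k) =
        σ⁻¹ * ∑ k ∈ Finset.range m, σ⁻¹ ^ (m - k) := by
      rw [Finset.mul_sum]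
      refine Finset.sum_congr rfl fun k hk => ?_
      rw [show m + 1 - k = m - k + 1 by have := Finset.mem_range.1 hk; omega, pow_succ']
    rw [this, ih, show m + 1 - m = 1 by omega, pow_succ]
    field_simp
    linear_combination σ⁻¹ ^ m * mul_inv_cancel₀ h1.ne'

/-- Cauchy–Schwarz with weights `σ ^ (m - k)`, which avoids the factor `m` that uniform weights
would cost. -/
theorem sq_sum_sqrt_le {σ : ℝ} (hσ : 1 < σ) {Q : ℕ → ℝ} (hQ : ∀ k, 0 ≤ Q k) (m : ℕ) :
    (∑ k ∈ Finset.range m, √(Q k)) ^ 2 ≤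
      1 / (σ - 1) * ∑ k ∈ Finset.range m, σ ^ (m - k) * Q k := by
  have h1 : 0 < σ := by linarith
  refine (Finset.sum_sq_le_sum_mul_sum_of_sq_le_mul (Finset.range m)
    (f := fun k => σ⁻¹ ^ (m - k)) (g := fun k => σ ^ (m - k) * Q k) (fun k _ => by positivity)
    (fun k _ => mul_nonneg (by positivity) (hQ k)) fun k _ => le_of_eq ?_).trans ?_
  · rw [Real.sq_sqrt (hQ k), ← mul_assoc, ← mul_pow, inv_mul_cancel₀ h1.ne', one_pow, one_mul]
  · exact mul_le_mul_of_nonneg_right (sum_range_inv_pow_le hσ m)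
      (Finset.sum_nonneg fun k _ => mul_nonneg (by positivity) (hQ k))

section Dyadic

variable {Ω : Type*} [MeasurableSpace Ω] {P : Measure Ω} [IsProbabilityMeasure P]
  {X : ℕ → Ω → ℝ} {q r : ℝ} {w t : ℕ → ℝ}

/-- The sum of the squares of all the centered block sums which occur in the chaining between the
levels `k` and `k + 1`. -/
noncomputable def levelSq (P : Measure Ω) (X : ℕ → Ω → ℝ) (w : ℕ → ℝ) (m k : ℕ) (ω : Ω) : ℝ :=
  blockSq P X m k (clip (w k)) ω + blockSq P X m (k + 1) (clipUp w k) ω +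
    blockSq P X m (k + 1) (clipDown w k) ω

omit [IsProbabilityMeasure P] in
theorem levelSq_nonneg (m k : ℕ) (ω : Ω) : 0 ≤ levelSq P X w m k ω :=
  add_nonneg (add_nonneg (blockSq_nonneg _ _ _ _) (blockSq_nonneg _ _ _ _))
    (blockSq_nonneg _ _ _ _)

theorem clipUp_monotone (h : GeometricLevels q r w) (k : ℕ) : Monotone (clipUp w k) :=
  (clip_sub_clip_monotone (h.pos k).le (h.monotone k.le_succ)).max monotone_const

theorem clipDown_monotone (h : GeometricLevels q r w) (k : ℕ) : Monotone (clipDown w k) :=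
  (clip_sub_clip_monotone (h.pos k).le (h.monotone k.le_succ)).min monotone_const

theorem abs_increment_le (h : GeometricLevels q r w) (k : ℕ) (x : ℝ) :
    |clip (w (k + 1)) x - clip (w k) x| ≤ w (k + 1) :=
  (abs_clip_sub_clip_le (h.pos k).le (h.monotone k.le_succ) x).trans
    (indicator_le_self' (fun _ _ => (h.pos _).le) x)

theorem abs_clipUp_le_level (h : GeometricLevels q r w) (k : ℕ) (x : ℝ) :
    |clipUp w k x| ≤ w (k + 1) := (abs_clipUp_le w k x).trans (abs_increment_le h k x)

theorem abs_clipDown_le_level (h : GeometricLevels q r w) (k : ℕ) (x : ℝ) :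
    |clipDown w k x| ≤ w (k + 1) := (abs_clipDown_le w k x).trans (abs_increment_le h k x)

theorem abs_sum_dev_clip_le (h : GeometricLevels q r w) (hX : ∀ n, 1 ≤ n → Measurable (X n))
    (ht : ∀ n, 1 ≤ n → ∀ l, P.real {ω | w l < |X n ω|} ≤ t l) {m : ℕ} (hm : 1 ≤ m) {j : ℕ}
    (hj : j ≤ 2 ^ m) (ω : Ω) :
    |∑ i ∈ Finset.Ioc 0 j, dev P X (clip (w m)) i ω| ≤
      4 * ∑ k ∈ Finset.range m, √(levelSq P X w m k ω) +
        ∑ k ∈ Finset.range m, 4 * (2 ^ k * (w (k + 1) * t k)) := by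
  have hup : ∀ k i, 1 ≤ i → Integrable (fun ω => clipUp w k (X i ω)) P := fun k i hi =>
    integrable_comp_of_monotone (clipUp_monotone h k) (abs_clipUp_le_level h k) (hX i hi)
  have hdown : ∀ k i, 1 ≤ i → Integrable (fun ω => clipDown w k (X i ω)) P := fun k i hi =>
    integrable_comp_of_monotone (clipDown_monotone h k) (abs_clipDown_le_level h k) (hX i hi)
  have hclip : ∀ k i, 1 ≤ i → Integrable (fun ω => clip (w k) (X i ω)) P := fun k i hi =>
    integrable_comp_of_monotone (clip_monotone _) (abs_clip_le (h.pos k).le) (hX i hi)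
  have hmean : ∀ k i, 1 ≤ i →
      ∫ ω, clipUp w k (X i ω) ∂P - ∫ ω, clipDown w k (X i ω) ∂P ≤ w (k + 1) * t k := by
    intro k i hi
    rw [← integral_sub (hup k i hi) (hdown k i hi)]
    simp only [clipUp_sub_clipDown]
    exact integral_abs_clip_sub_clip_le h (hX i hi) (ht i hi) k
  have key := abs_sum_Ioc_le_chain (m := m) (ξ := fun k i => dev P X (clip (w k)) i ω)
    (ζ := fun k i => dev P X (clipUp w k) i ω - dev P X (clipDown w k) i ω +
      2 * (w (k + 1) * t k))
    (A := fun k => √(blockSq P X m k (clip (w k)) ω))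
    (B := fun k => √(blockSq P X m (k + 1) (clipUp w k) ω) +
      √(blockSq P X m (k + 1) (clipDown w k) ω) + 4 * (2 ^ k * (w (k + 1) * t k)))
    ?_ (fun k b hb => abs_sum_dev_le_sqrt_blockSq hb _ ω) ?_ m 0 (by simp) j hj
  · refine (le_of_eq_of_le (by simp) key).trans ?_
    have h1 : ∀ k, √(blockSq P X m k (clip (w k)) ω) +
        (√(blockSq P X m (k + 1) (clipUp w k) ω) + √(blockSq P X m (k + 1) (clipDown w k) ω) +
          4 * (2 ^ k * (w (k + 1) * t k))) ≤
        3 * √(levelSq P X w m k ω) + 4 * (2 ^ k * (w (k + 1) * t k)) := fun k => by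
      have := sqrt_add_sqrt_add_sqrt_le (blockSq_nonneg (P := P) (X := X) m k (clip (w k)) ω)
        (blockSq_nonneg (P := P) (X := X) m (k + 1) (clipUp w k) ω)
        (blockSq_nonneg (P := P) (X := X) m (k + 1) (clipDown w k) ω)
      rw [levelSq]
      linarith
    have h2 := Finset.sum_le_sum fun k (_ : k ∈ Finset.range m) => h1 k
    -- The extra base term `A 0` of the chaining is absorbed here, turning the coefficient 3 into 4.
    have h3 : √(blockSq P X m 0 (clip (w 0)) ω) ≤ ∑ k ∈ Finset.range m, √(levelSq P X w m k ω) := by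
      refine le_trans (Real.sqrt_le_sqrt ?_) (Finset.single_le_sum
        (f := fun k => √(levelSq P X w m k ω)) (fun k _ => Real.sqrt_nonneg _)
        (Finset.mem_range.2 hm))
      have := blockSq_nonneg (P := P) (X := X) m (0 + 1) (clipUp w 0) ω
      have := blockSq_nonneg (P := P) (X := X) m (0 + 1) (clipDown w 0) ω
      simp only [levelSq]
      linarith
    rw [Finset.sum_add_distrib (f := fun k => 3 * √(levelSq P X w m k ω)),
      ← Finset.mul_sum] at h2
    linarith
  · intro k i hi
    -- With `u ≥ 0 ≥ d` the two parts of the increment, `|u + d - E (u + d)| ≤ (u - E u) - (d - E d)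
    -- + 2 * (E u - E d)`, and `E u - E d ≤ w (k + 1) * t k`.
    have e : dev P X (clip (w (k + 1))) i ω - dev P X (clip (w k)) i ω =
        (clipUp w k (X i ω) + clipDown w k (X i ω)) -
          (∫ ω, clipUp w k (X i ω) ∂P + ∫ ω, clipDown w k (X i ω) ∂P) := by
      rw [← integral_add (hup k i hi) (hdown k i hi)]
      simp only [clipUp_add_clipDown]
      rw [integral_sub (hclip _ i hi) (hclip _ i hi)]
      simp only [dev]
      ring
    have h1 := hmean k i hi
    have h2 := clipUp_nonneg w k (X i ω)
    have h3 := clipDown_nonpos w k (X i ω)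
    have h4 : 0 ≤ ∫ ω, clipUp w k (X i ω) ∂P := integral_nonneg fun ω => clipUp_nonneg w k _
    have h5 : ∫ ω, clipDown w k (X i ω) ∂P ≤ 0 := integral_nonpos fun ω => clipDown_nonpos w k _
    refine (congrArg abs e).trans_le ?_
    simp only [dev]
    rw [abs_le]
    constructor <;> linarith
  · intro k b hb
    have h1 := abs_sum_dev_le_sqrt_blockSq (P := P) (X := X) hb (clipUp w k) ω
    have h2 := abs_sum_dev_le_sqrt_blockSq (P := P) (X := X) hb (clipDown w k) ω
    have h3 := le_abs_self
      (∑ i ∈ Finset.Ioc (b * 2 ^ (k + 1)) ((b + 1) * 2 ^ (k + 1)), dev P X (clipUp w k) i ω)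
    have h4 := neg_abs_le
      (∑ i ∈ Finset.Ioc (b * 2 ^ (k + 1)) ((b + 1) * 2 ^ (k + 1)), dev P X (clipDown w k) i ω)
    have hcard : (Finset.Ioc (b * 2 ^ (k + 1)) ((b + 1) * 2 ^ (k + 1))).card = 2 ^ (k + 1) := by
      rw [Nat.card_Ioc, add_mul, one_mul, Nat.add_sub_cancel_left]
    rw [Finset.sum_add_distrib, Finset.sum_sub_distrib, Finset.sum_const, hcard, nsmul_eq_mul]
    have h5 : ((2 ^ (k + 1) : ℕ) : ℝ) * (2 * (w (k + 1) * t k)) =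
        4 * (2 ^ k * (w (k + 1) * t k)) := by push_cast; ring
    rw [h5]
    linarith

theorem integral_levelSq_le (h : GeometricLevels q r w) {C : ℝ}
    (hC : ∀ k ℓ : ℕ, 1 ≤ ℓ → ∀ f : ℕ → ℝ → ℝ, (∀ i, 1 ≤ i → Monotone (f i)) →
      (∀ i ∈ Finset.Icc (k + 1) (k + ℓ), MemLp (fun ω => f i (X i ω)) 2 P) →
      variance (fun ω => ∑ i ∈ Finset.Icc (k + 1) (k + ℓ), f i (X i ω)) P ≤
        C * ∑ i ∈ Finset.Icc (k + 1) (k + ℓ), variance (fun ω => f i (X i ω)) P)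
    (hX : ∀ n, 1 ≤ n → Measurable (X n))
    (ht : ∀ n, 1 ≤ n → ∀ l, P.real {ω | w l < |X n ω|} ≤ t l) {m k : ℕ} (hk : k < m) :
    Integrable (levelSq P X w m k) P ∧
      ∫ ω, levelSq P X w m k ω ∂P ≤ 3 * |C| * 2 ^ m * truncSq w t (k + 1) := by
  have ht0 : ∀ l, 0 ≤ t l := fun l => measureReal_nonneg.trans (ht 1 le_rfl l)
  obtain ⟨i1, b1⟩ := integral_blockSq_le hC hX (clip_monotone (w k)) (abs_clip_le (h.pos k).le)
    (v := truncSq w t (k + 1)) (fun i hi =>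
      (integral_clip_sq_le h (hX i hi) (ht i hi) k).trans (by
        rw [truncSq, truncSq, Finset.sum_range_succ]
        have := mul_nonneg (sq_nonneg (w (k + 1))) (ht0 k)
        linarith)) hk.le
  obtain ⟨i2, b2⟩ := integral_blockSq_le hC hX (clipUp_monotone h k) (abs_clipUp_le_level h k)
    (v := truncSq w t (k + 1)) (fun i hi => integral_sq_le_truncSq_succ h (hX i hi) (ht i hi)
      (clipUp_monotone h k) (abs_clipUp_le w k)) (Nat.succ_le_of_lt hk)
  obtain ⟨i3, b3⟩ := integral_blockSq_le hC hX (clipDown_monotone h k)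
    (abs_clipDown_le_level h k)
    (v := truncSq w t (k + 1)) (fun i hi => integral_sq_le_truncSq_succ h (hX i hi) (ht i hi)
      (clipDown_monotone h k) (abs_clipDown_le w k)) (Nat.succ_le_of_lt hk)
  refine ⟨(i1.add i2).add i3, ?_⟩
  have e : ∫ ω, levelSq P X w m k ω ∂P = ∫ ω, blockSq P X m k (clip (w k)) ω ∂P +
      ∫ ω, blockSq P X m (k + 1) (clipUp w k) ω ∂P +
      ∫ ω, blockSq P X m (k + 1) (clipDown w k) ω ∂P := by
    rw [← integral_add i1 i2]
    exact integral_add (i1.add i2) i3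
  rw [e]
  linarith

theorem measureReal_lt_maxCenteredSum_le (h : GeometricLevels q r w) {C : ℝ}
    (hC : ∀ k ℓ : ℕ, 1 ≤ ℓ → ∀ f : ℕ → ℝ → ℝ, (∀ i, 1 ≤ i → Monotone (f i)) →
      (∀ i ∈ Finset.Icc (k + 1) (k + ℓ), MemLp (fun ω => f i (X i ω)) 2 P) →
      variance (fun ω => ∑ i ∈ Finset.Icc (k + 1) (k + ℓ), f i (X i ω)) P ≤
        C * ∑ i ∈ Finset.Icc (k + 1) (k + ℓ), variance (fun ω => f i (X i ω)) P)
    (hX : ∀ n, 1 ≤ n → Measurable (X n))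
    (ht : ∀ n, 1 ≤ n → ∀ l, P.real {ω | w l < |X n ω|} ≤ t l)
    (hs : Summable fun l => q ^ l * t l) {σ : ℝ} (hσ : 1 < σ) {ε : ℝ} (hε : 0 < ε) {m : ℕ}
    (hm : 1 ≤ m)
    (hd1 : (∑ k ∈ Finset.range m, 4 * (2 ^ k * (w (k + 1) * t k))) / w m ≤ ε / 4)
    (hd2 : 2 ^ m * (∑' l, w (l + m + 1) * t (l + m)) / w m ≤ ε / 4) :
    P.real {ω | ε * w m < maxCenteredSum P X (2 ^ m) ω} ≤
      2 ^ m * t m + 192 * |C| / ((σ - 1) * ε ^ 2) * (2 ^ m / w m ^ 2 *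
        ∑ k ∈ Finset.range m, σ ^ (m - k) * truncSq w t (k + 1)) := by
  have hw := h.pos m
  have hσ1 : 0 < σ - 1 := sub_pos.2 hσ
  have hσ0 : 0 < σ := by linarith
  rw [div_le_iff₀ hw] at hd1 hd2
  set Q : Ω → ℝ := fun ω => ∑ k ∈ Finset.range m, σ ^ (m - k) * levelSq P X w m k ω with hQ
  set E : Set Ω := {ω | (ε * w m / 8) ^ 2 * (σ - 1) ≤ Q ω} with hE
  have hsub : {ω | ε * w m < maxCenteredSum P X (2 ^ m) ω} ⊆
      (⋃ i ∈ Finset.Icc 1 (2 ^ m), {ω | w m < |X i ω|}) ∪ E := by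
    intro ω hω
    rw [mem_ofPred_eq, lt_maxCenteredSum_iff P X (by positivity)] at hω
    obtain ⟨j, hj, hω⟩ := hω
    by_cases hmem : ω ∈ ⋃ i ∈ Finset.Icc 1 (2 ^ m), {ω | w m < |X i ω|}
    · exact Or.inl hmem
    right
    simp only [mem_iUnion, mem_ofPred_eq, not_exists, not_lt] at hmem
    rw [Finset.mem_Icc] at hj
    have hsplit : ∑ i ∈ Finset.Icc 1 j, (X i ω - ∫ ω', X i ω' ∂P) =
        ∑ i ∈ Finset.Ioc 0 j, dev P X (clip (w m)) i ω -
          ∑ i ∈ Finset.Ioc 0 j, (∫ ω', X i ω' ∂P - ∫ ω', clip (w m) (X i ω') ∂P) := by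
      rw [← Finset.sum_sub_distrib, show Finset.Icc 1 j = Finset.Ioc 0 j from rfl]
      refine Finset.sum_congr rfl fun i hi => ?_
      rw [Finset.mem_Ioc] at hi
      rw [dev, clip_eq_self (hmem i (Finset.mem_Icc.2 ⟨hi.1, hi.2.trans hj.2⟩))]
      ring
    have hdrift : |∑ i ∈ Finset.Ioc 0 j, (∫ ω', X i ω' ∂P - ∫ ω', clip (w m) (X i ω') ∂P)| ≤
        2 ^ m * (∑' l, w (l + m + 1) * t (l + m)) := by
      refine (Finset.abs_sum_le_sum_abs _ _).trans ?_
      have hnn : 0 ≤ ∑' l, w (l + m + 1) * t (l + m) := tsum_nonneg fun l =>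
        mul_nonneg (h.pos _).le (measureReal_nonneg.trans (ht 1 le_rfl _))
      calc _ ≤ ∑ i ∈ Finset.Ioc 0 j, ∑' l, w (l + m + 1) * t (l + m) :=
            Finset.sum_le_sum fun i hi => by
              have hi1 : 1 ≤ i := (Finset.mem_Ioc.1 hi).1
              exact abs_integral_sub_integral_clip_le h (hX i hi1) (ht i hi1) hs m
        _ = j * ∑' l, w (l + m + 1) * t (l + m) := by simp
        _ ≤ _ := by gcongr; exact_mod_cast hj.2
    have hchain := abs_sum_dev_clip_le h hX ht hm hj.2 ω
    rw [hsplit] at hω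
    have h1 := hω.trans_le (abs_sub _ _)
    -- The two drifts use up half of `ε * w m`, and the chaining coefficient is 4. Squaring gives
    -- 64, which with the 3 of `integral_levelSq_le` produces 192.
    have h2 : ε * w m / 8 ≤ ∑ k ∈ Finset.range m, √(levelSq P X w m k ω) := by linarith
    have h3 : (ε * w m / 8) ^ 2 ≤ (∑ k ∈ Finset.range m, √(levelSq P X w m k ω)) ^ 2 := by
      gcongr
    have h4 := h3.trans (sq_sum_sqrt_le hσ (fun k => levelSq_nonneg (P := P) m k ω) m)
    rw [one_div, inv_mul_eq_div, le_div_iff₀ hσ1] at h4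
    exact h4
  have hint : ∀ k ∈ Finset.range m,
      Integrable (fun ω => σ ^ (m - k) * levelSq P X w m k ω) P := fun k hk =>
    (integral_levelSq_le h hC hX ht (Finset.mem_range.1 hk)).1.const_mul _
  have hQint : ∫ ω, Q ω ∂P ≤
      3 * |C| * 2 ^ m * ∑ k ∈ Finset.range m, σ ^ (m - k) * truncSq w t (k + 1) := by
    rw [hQ, integral_finsetSum _ hint, Finset.mul_sum]
    refine Finset.sum_le_sum fun k hk => ?_
    rw [integral_const_mul]
    have := (integral_levelSq_le h hC hX ht (Finset.mem_range.1 hk)).2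
    calc _ ≤ σ ^ (m - k) * (3 * |C| * 2 ^ m * truncSq w t (k + 1)) := by gcongr
      _ = _ := by ring
  have hmarkov := mul_meas_ge_le_integral_of_nonneg (μ := P) (f := Q)
    (Eventually.of_forall fun ω => Finset.sum_nonneg fun k _ =>
      mul_nonneg (by positivity) (levelSq_nonneg m k ω)) (integrable_finsetSum _ hint)
    ((ε * w m / 8) ^ 2 * (σ - 1))
  have hunion : P.real (⋃ i ∈ Finset.Icc 1 (2 ^ m), {ω | w m < |X i ω|}) ≤ 2 ^ m * t m := by
    refine (measureReal_biUnion_finset_le _ _).trans ?_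
    refine (Finset.sum_le_sum fun i hi => ht i (Finset.mem_Icc.1 hi).1 m).trans ?_
    simp
  have hEle : P.real E ≤ 192 * |C| / ((σ - 1) * ε ^ 2) * (2 ^ m / w m ^ 2 *
        ∑ k ∈ Finset.range m, σ ^ (m - k) * truncSq w t (k + 1)) := by
    have h1 := hmarkov.trans hQint
    rw [mul_comm, ← le_div_iff₀ (by positivity)] at h1
    refine h1.trans (le_of_eq ?_)
    field_simp
    ring
  exact (measureReal_mono hsub).trans ((measureReal_union_le _ _).trans (add_le_add hunion hEle))

theorem summable_dyadic (h : GeometricLevels q r w) (hvar : VarianceInequality P X)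
    (hX : ∀ n, 1 ≤ n → Measurable (X n))
    (ht : ∀ n, 1 ≤ n → ∀ l, P.real {ω | w l < |X n ω|} ≤ t l)
    (hs : Summable fun l => q ^ l * t l) {ε : ℝ} (hε : 0 < ε) :
    Summable fun m : ℕ => (q / 2) ^ m * P.real {ω | ε * w m < maxCenteredSum P X (2 ^ m) ω} := by
  obtain ⟨C, hC⟩ := hvar
  have hq := h.two_le
  have ht0 : ∀ l, 0 ≤ t l := fun l => measureReal_nonneg.trans (ht 1 le_rfl l)
  obtain ⟨σ, hσ, hσr⟩ : ∃ σ, 1 < σ ∧ σ * q < r ^ 2 := by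
    obtain ⟨σ, h1, h2⟩ := exists_between ((one_lt_div (by positivity)).2 h.lt_sq)
    exact ⟨σ, h1, (lt_div_iff₀ (by positivity)).1 h2⟩
  have hsum := hs.add ((h.summable_sum_truncSq ht0 hs hσ hσr).mul_left
    (192 * |C| / ((σ - 1) * ε ^ 2)))
  refine Summable.of_norm_bounded_eventually_nat hsum ?_
  filter_upwards [eventually_ge_atTop 1,
    (h.tendsto_sum_increments ht0 hs).eventually_le_const (show 0 < ε / 4 by positivity),
    (h.tendsto_tail ht0 hs).eventually_le_const (show 0 < ε / 4 by positivity)] with m hm h1 h2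
  rw [Real.norm_of_nonneg (by positivity)]
  have := measureReal_lt_maxCenteredSum_le h hC hX ht hs hσ hε hm h1 h2
  refine (mul_le_mul_of_nonneg_left this (by positivity)).trans (le_of_eq ?_)
  rw [div_pow]
  field_simp

end Dyadic

/-! ### Growth of `x * L x` -/

/-- Both `δ * log x + log (L x)` and `δ * log x - log (L x)` are eventually nondecreasing, their
derivatives being `(δ ± x * L' x / L x) / x`. -/
theorem exists_abs_log_sub_log_le {L : ℝ → ℝ} (hL : IsSlowlyVarying L)
    (hLdiff : ∃ A : ℝ, 0 < A ∧ DifferentiableOn ℝ L (Ici A))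
    (hLderiv : Tendsto (fun x => x * deriv L x / L x) atTop (𝓝 0)) {δ : ℝ} (hδ : 0 < δ) :
    ∃ x₀, 0 < x₀ ∧ (∀ x, x₀ ≤ x → 0 < L x) ∧ ∀ x y, x₀ ≤ x → x ≤ y →
      |Real.log (L y) - Real.log (L x)| ≤ δ * (Real.log y - Real.log x) := by
  obtain ⟨⟨A, hA, hpos, -⟩, -⟩ := hL
  obtain ⟨B, hB, hdiff⟩ := hLdiff
  obtain ⟨D, hD⟩ := eventually_atTop.1
    ((tendsto_order.1 hLderiv.abs).2 δ (by simpa using hδ))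
  set x₀ := max (max A D) (B + 1) with hx₀
  have hA' : A ≤ x₀ := (le_max_left _ _).trans (le_max_left _ _)
  have hD' : D ≤ x₀ := (le_max_right _ _).trans (le_max_left _ _)
  have hB' : B < x₀ := (lt_add_one B).trans_le (le_max_right _ _)
  have hx₀pos : 0 < x₀ := hA.trans_le hA'
  have hLpos : ∀ x, x₀ ≤ x → 0 < L x := fun x hx => hpos x (hA'.trans hx)
  have hder : ∀ c : ℝ, ∀ x, x₀ ≤ x → HasDerivAt
      (fun x => δ * Real.log x + c * Real.log (L x)) (δ * x⁻¹ + c * (deriv L x / L x)) x := by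
    intro c x hx
    have hd : HasDerivAt L (deriv L x) x :=
      ((hdiff x (hB'.le.trans hx)).differentiableAt
        (Ici_mem_nhds (hB'.trans_le hx))).hasDerivAt
    exact ((Real.hasDerivAt_log (hx₀pos.trans_le hx).ne').const_mul δ).add
      ((hd.log (hLpos x hx).ne').const_mul c)
  have hmono : ∀ c : ℝ, |c| = 1 →
      MonotoneOn (fun x => δ * Real.log x + c * Real.log (L x)) (Ici x₀) := by
    intro c hc
    refine monotoneOn_of_deriv_nonneg (convex_Ici x₀)
      (fun x hx => (hder c x hx).continuousAt.continuousWithinAt)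
      (fun x hx => (hder c x (interior_subset hx)).differentiableAt.differentiableWithinAt)
      fun x hx => ?_
    have hx' : x₀ ≤ x := interior_subset hx
    have hxpos := hx₀pos.trans_le hx'
    rw [(hder c x hx').deriv]
    have h1 := hD x (hD'.trans hx')
    have h2 : |c * (x * deriv L x / L x)| < δ := by rwa [abs_mul, hc, one_mul]
    have h3 : δ * x⁻¹ + c * (deriv L x / L x) = (δ + c * (x * deriv L x / L x)) / x := by
      field_simp
    rw [h3]
    exact div_nonneg (by linarith [(abs_lt.1 h2).1]) hxpos.le
  refine ⟨x₀, hx₀pos, hLpos, fun x y hx hxy => abs_le.2 ⟨?_, ?_⟩⟩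
  · have := hmono 1 (by simp) hx (hx.trans hxy) hxy
    simp only at this
    linarith
  · have := hmono (-1) (by simp) hx (hx.trans hxy) hxy
    simp only at this
    linarith

theorem exists_growth_bounds {p s : ℝ} (hp : 1 ≤ p) (hs : 1 < s) {L : ℝ → ℝ}
    (hL : IsSlowlyVarying L) (hLdiff : ∃ A : ℝ, 0 < A ∧ DifferentiableOn ℝ L (Ici A))
    (hLderiv : Tendsto (fun x => x * deriv L x / L x) atTop (𝓝 0))
    (hLone : p = 1 → (∀ x, 0 ≤ x → 1 ≤ L x) ∧ MonotoneOn L (Ici 0)) :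
    ∃ x₀, 0 < x₀ ∧ (∀ x, x₀ ≤ x → 0 < L x) ∧ ∀ x y, x₀ ≤ x → x ≤ y →
      (y / x) ^ (1 / p) * (x * L x) ≤ y * L y ∧ y * L y ≤ (y / x) ^ s * (x * L x) := by
  -- The upper bound needs `1 + δ ≤ s` and the lower one `1 / p ≤ 1 - δ`. The latter is impossible
  -- for `p = 1`, where monotonicity of `L` takes its place.
  obtain ⟨δ, hδ, hδs, hδp⟩ : ∃ δ : ℝ, 0 < δ ∧ δ ≤ s - 1 ∧ (p ≠ 1 → δ ≤ 1 - 1 / p) := by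
    rcases eq_or_ne p 1 with h | h
    · exact ⟨s - 1, by linarith, le_rfl, fun h' => absurd h h'⟩
    · have hlt : 1 < p := lt_of_le_of_ne hp h.symm
      have : 1 / p < 1 := (div_lt_one (by linarith)).2 hlt
      exact ⟨min (s - 1) (1 - 1 / p), lt_min (by linarith) (by linarith), min_le_left _ _,
        fun _ => min_le_right _ _⟩
  obtain ⟨x₀, hx₀, hpos, hlog⟩ := exists_abs_log_sub_log_le hL hLdiff hLderiv hδ
  refine ⟨x₀, hx₀, hpos, fun x y hx hxy => ?_⟩
  have hx' := hx₀.trans_le hx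
  have hy' := hx'.trans_le hxy
  have hLx := hpos x hx
  have hLy := hpos y (hx.trans hxy)
  have hlogxy : Real.log x ≤ Real.log y := Real.log_le_log hx' hxy
  have hb := abs_le.1 (hlog x y hx hxy)
  have hpow : 0 < y / x := div_pos hy' hx'
  constructor
  · rcases eq_or_ne p 1 with h | h
    · have := (hLone h).2 (mem_Ici.2 hx'.le) (mem_Ici.2 hy'.le) hxy
      rw [h, div_one, Real.rpow_one]
      calc y / x * (x * L x) = y * L x := by field_simp
        _ ≤ _ := by gcongr
    · rw [← Real.log_le_log_iff (by positivity) (by positivity),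
        Real.log_mul (by positivity) (by positivity), Real.log_mul hx'.ne' hLx.ne',
        Real.log_mul hy'.ne' hLy.ne', Real.log_rpow hpow, Real.log_div hy'.ne' hx'.ne']
      have := mul_le_mul_of_nonneg_right (hδp h) (sub_nonneg.2 hlogxy)
      linarith
  · rw [← Real.log_le_log_iff (by positivity) (by positivity),
      Real.log_mul hy'.ne' hLy.ne',
      Real.log_mul (by positivity) (by positivity), Real.log_mul hx'.ne' hLx.ne',
      Real.log_rpow hpow, Real.log_div hy'.ne' hx'.ne']
    have := mul_le_mul_of_nonneg_right hδs (sub_nonneg.2 hlogxy)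
    linarith

/-- Lower and upper power bounds for the growth of `f` on `[x₀, ∞)`. -/
structure GrowthBounds (p s x₀ : ℝ) (f : ℝ → ℝ) : Prop where
  pos : 0 < x₀
  one_le : 1 ≤ p
  one_lt : 1 < s
  mul_lt : s * p < 2
  f_pos : ∀ x, x₀ ≤ x → 0 < f x
  lower : ∀ x y, x₀ ≤ x → x ≤ y → (y / x) ^ (1 / p) * f x ≤ f y
  upper : ∀ x y, x₀ ≤ x → x ≤ y → f y ≤ (y / x) ^ s * f x

namespace GrowthBounds

variable {p s x₀ : ℝ} {f : ℝ → ℝ}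

theorem strictMonoOn (h : GrowthBounds p s x₀ f) : StrictMonoOn f (Ici x₀) := by
  intro x hx y hy hxy
  have h0 := h.pos.trans_le hx
  have hp := h.one_le
  refine lt_of_lt_of_le ?_ (h.lower x y hx hxy.le)
  exact lt_mul_of_one_lt_left (h.f_pos x hx)
    (Real.one_lt_rpow ((one_lt_div h0).2 hxy) (by positivity))

theorem le_of_le_mul (h : GrowthBounds p s x₀ f) {x y M : ℝ} (hx : x₀ ≤ x)
    (hxy : f y ≤ M * f x) : y ≤ max 1 (M ^ p) * x := by
  have h0 := h.pos.trans_le hx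
  have hp := h.one_le
  rcases le_total y x with hle | hle
  · exact hle.trans (le_mul_of_one_le_left h0.le (le_max_left _ _))
  · have h1 := (h.lower x y hx hle).trans hxy
    have h2 := le_of_mul_le_mul_right h1 (h.f_pos x hx)
    have h3 : 0 ≤ y / x := div_nonneg (h0.le.trans hle) h0.le
    have h4 := Real.rpow_le_rpow (by positivity) h2 (by linarith : 0 ≤ p)
    rw [← Real.rpow_mul h3, one_div_mul_cancel (by positivity), Real.rpow_one,
      div_le_iff₀ h0] at h4
    exact h4.trans (mul_le_mul_of_nonneg_right (le_max_right _ _) h0.le)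

theorem exists_levels (h : GrowthBounds p s x₀ f) (hf : ContinuousOn f (Ici x₀)) {β : ℝ}
    (hβ : 1 ≤ β) : ∃ w : ℕ → ℝ, (∀ m, x₀ ≤ w m) ∧ ∀ m, f (w m) = f x₀ * β ^ m := by
  have hp := h.one_le
  have hf0 := h.f_pos x₀ le_rfl
  have hx := h.pos
  have : ∀ m : ℕ, ∃ w, x₀ ≤ w ∧ f w = f x₀ * β ^ m := by
    intro m
    have hb : 1 ≤ β ^ m := one_le_pow₀ hβ
    -- The lower growth bound shows that `f` has reached `β ^ m * f x₀` by the point `(β ^ m) ^ p *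
    -- x₀`, so the intermediate value theorem applies.
    have hbp : 1 ≤ (β ^ m) ^ p := Real.one_le_rpow hb (by linarith)
    have hle : x₀ ≤ (β ^ m) ^ p * x₀ := le_mul_of_one_le_left hx.le hbp
    have h1 := h.lower x₀ _ le_rfl hle
    rw [mul_div_cancel_right₀ _ hx.ne', ← Real.rpow_mul (by positivity),
      mul_one_div_cancel (by positivity), Real.rpow_one] at h1
    obtain ⟨z, hz, hfz⟩ := intermediate_value_Icc hle (hf.mono Icc_subset_Ici_self)
      ⟨le_mul_of_one_le_right hf0.le hb, by rwa [mul_comm]⟩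
    exact ⟨z, hz.1, hfz⟩
  choose w hw using this
  exact ⟨w, fun m => (hw m).1, fun m => (hw m).2⟩

/-- Inverting the growth bounds, a factor `2 ^ α` in `f` means a factor between `2 ^ (α / s)` and `2
^ (α * p)` in the argument; `s * p < 2` gives `q < r ^ 2`, and `α * p ≥ 1` gives `2 ≤ q`. -/
theorem geometricLevels (h : GrowthBounds p s x₀ f) {α : ℝ} (hα : 1 / p ≤ α) {w : ℕ → ℝ}
    (hw : ∀ m, x₀ ≤ w m) (hfw : ∀ m, f (w m) = f x₀ * ((2 : ℝ) ^ α) ^ m) :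
    GeometricLevels (2 ^ (α * p)) (2 ^ (α / s)) w := by
  have hp := h.one_le
  have hs := h.one_lt
  have hα0 : 0 < α := lt_of_lt_of_le (by positivity) hα
  have hαp : 1 ≤ α * p := by rwa [div_le_iff₀ (by positivity)] at hα
  have hpos : ∀ k, 0 < w k := fun k => h.pos.trans_le (hw k)
  have hsucc : ∀ k, f (w (k + 1)) = 2 ^ α * f (w k) := fun k => by rw [hfw, hfw]; ring
  have hβ : (1 : ℝ) < 2 ^ α := Real.one_lt_rpow one_lt_two hα0
  have hmono : ∀ k, w k ≤ w (k + 1) := fun k => by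
    rw [← h.strictMonoOn.le_iff_le (hw k) (hw (k + 1)), hsucc]
    exact le_mul_of_one_le_left (h.f_pos _ (hw k)).le hβ.le
  refine ⟨hpos, fun k => ?_, fun k => ?_, Real.one_lt_rpow one_lt_two (by positivity), ?_, ?_⟩
  · have h1 := h.upper _ _ (hw k) (hmono k)
    rw [hsucc] at h1
    have h2 := le_of_mul_le_mul_right h1 (h.f_pos _ (hw k))
    rw [← le_div_iff₀ (hpos k), ← Real.rpow_le_rpow_iff (by positivity)
      (div_pos (hpos _) (hpos _)).le (by linarith : 0 < s), ← Real.rpow_mul (by norm_num),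
      div_mul_cancel₀ _ (by positivity)]
    exact h2
  · have h1 := h.le_of_le_mul (hw k) (hsucc k).le
    rwa [← Real.rpow_mul (by norm_num), max_eq_right
      (Real.one_le_rpow one_le_two (by positivity))] at h1
  · calc (2 : ℝ) = 2 ^ (1 : ℝ) := (Real.rpow_one 2).symm
      _ ≤ _ := Real.rpow_le_rpow_of_exponent_le one_le_two hαp
  · rw [← Real.rpow_natCast, ← Real.rpow_mul (by norm_num)]
    refine Real.rpow_lt_rpow_of_exponent_lt one_lt_two ?_
    have := h.mul_lt
    push_cast
    rw [div_mul_eq_mul_div, lt_div_iff₀ (by positivity)]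
    nlinarith

end GrowthBounds

/-! ### Moments and tails at geometric levels -/

theorem sum_pow_indicator_le {q a : ℝ} (hq : 2 ≤ q) (ha : 0 ≤ a) (N : ℕ) :
    ∑ m ∈ Finset.range N, {m : ℕ | q ^ m ≤ a}.indicator (fun m => q ^ m) m ≤ 2 * a := by
  induction N with
  | zero => simpa using ha
  | succ N ih =>
    by_cases hN : q ^ N ≤ a
    · have hgeom : ∀ N : ℕ, ∑ m ∈ Finset.range (N + 1), q ^ m ≤ 2 * q ^ N := by
        intro N
        induction N with
        | zero => simp
        | succ N ih =>
          rw [Finset.sum_range_succ]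
          have : 0 ≤ q ^ N := by positivity
          have : q ^ (N + 1) = q * q ^ N := by ring
          nlinarith
      calc _ ≤ ∑ m ∈ Finset.range (N + 1), q ^ m :=
            Finset.sum_le_sum fun m _ => indicator_le_self' (fun _ _ => by positivity) m
        _ ≤ 2 * q ^ N := hgeom N
        _ ≤ _ := by linarith
    · rw [Finset.sum_range_succ, indicator_of_notMem (by exact hN), add_zero]
      exact ih

/-- Pointwise, the sum of the `q ^ m` with `w m < |Y|` is geometric and at most twice its largest
term, hence at most `2 * |G| / c`. -/
theorem summable_pow_mul_tail {Ω : Type*} [MeasurableSpace Ω] {P : Measure Ω}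
    [IsProbabilityMeasure P] {Y G : Ω → ℝ} (hY : Measurable Y) (hG : Integrable G P) {q c : ℝ}
    (hq : 2 ≤ q) (hc : 0 < c) {w : ℕ → ℝ} (h : ∀ m ω, w m < |Y ω| → c * q ^ m ≤ |G ω|) :
    Summable fun m => q ^ m * P.real {ω | w m < |Y ω|} := by
  refine summable_of_sum_range_le (c := ∫ ω, 2 * (|G ω| / c) ∂P) (fun m => by positivity)
    fun N => ?_
  have hint : ∀ m ∈ Finset.range N, Integrable (fun ω =>
      {y : ℝ | w m < |y|}.indicator (fun _ => q ^ m) (Y ω)) P := fun m _ =>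
    integrable_indicator_abs hY _ _
  calc ∑ m ∈ Finset.range N, q ^ m * P.real {ω | w m < |Y ω|}
      = ∫ ω, ∑ m ∈ Finset.range N, {y : ℝ | w m < |y|}.indicator (fun _ => q ^ m) (Y ω) ∂P := by
        rw [integral_finsetSum _ hint]
        exact Finset.sum_congr rfl fun m _ => by rw [integral_indicator_abs hY, mul_comm]
    _ ≤ _ := by
        refine integral_mono (integrable_finsetSum _ hint) ((hG.abs.div_const c).const_mul 2)
          fun ω => ?_
        refine le_trans (Finset.sum_le_sum fun m _ => ?_)
          (sum_pow_indicator_le hq (by positivity : 0 ≤ |G ω| / c) N)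
        by_cases hm : w m < |Y ω|
        · rw [indicator_of_mem (by exact hm), indicator_of_mem]
          rw [mem_ofPred_eq, le_div_iff₀ hc, mul_comm]
          exact h m ω hm
        · rw [indicator_of_notMem (by exact hm)]
          exact indicator_nonneg (fun _ _ => by positivity) _

/-! ### The de Bruijn conjugate -/

/-- If `x * Lt x ≤ M`, then `L (x * Lt x)` is bounded by continuity on `[0, M]`, so `x * (Lt x * L
(x * Lt x))` is bounded, although it is eventually at least `x / 2`. -/
theorem tendsto_mul_deBruijnConjugate {L Lt : ℝ → ℝ} (hLcont : ContinuousOn L (Ici 0))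
    (hLt : IsDeBruijnConjugate L Lt) : Tendsto (fun x => x * Lt x) atTop atTop := by
  obtain ⟨⟨⟨A, hA, hpos, -⟩, -⟩, -, hconj⟩ := hLt
  rw [tendsto_atTop]
  intro M
  obtain ⟨B, hB⟩ := isCompact_Icc.exists_bound_of_continuousOn
    (hLcont.mono (Icc_subset_Ici_self : Icc 0 M ⊆ Ici 0))
  filter_upwards [eventually_ge_atTop A, eventually_gt_atTop (2 * (|M| * |B|)),
    hconj.eventually_const_le (show (1 / 2 : ℝ) < 1 by norm_num)] with x hxA hxB hx
  by_contra hlt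
  push Not at hlt
  have hx0 : 0 < x := hA.trans_le hxA
  have hLt0 := hpos x hxA
  have h1 := hB (x * Lt x) ⟨by positivity, hlt.le⟩
  have h2 : L (x * Lt x) ≤ |B| := (le_abs_self _).trans (h1.trans (le_abs_self _))
  have h3 : x * (Lt x * L (x * Lt x)) ≤ |M| * |B| := by
    rw [← mul_assoc]
    calc _ ≤ x * Lt x * |B| := by gcongr
      _ ≤ |M| * |B| := by gcongr; exact hlt.le.trans (le_abs_self _)
  have h4 : x * (1 / 2) ≤ x * (Lt x * L (x * Lt x)) := by gcongr
  linarith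

theorem eventually_le_two_mul_deBruijn {L Lt : ℝ → ℝ} (hLt : IsDeBruijnConjugate L Lt) :
    ∀ᶠ x in atTop, x ≤ 2 * ((x * Lt x) * L (x * Lt x)) := by
  filter_upwards [eventually_gt_atTop 0,
    hLt.2.2.eventually_const_le (show (1 / 2 : ℝ) < 1 by norm_num)] with x hx0 hx
  have : x * (1 / 2) ≤ x * (Lt x * L (x * Lt x)) := by gcongr
  linarith

/-! ### From dyadic to full series -/

theorem summable_div_two_pow_log {a : ℕ → ℝ} (ha : Summable a) (ha0 : ∀ m, 0 ≤ a m) :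
    Summable fun n : ℕ => a (Nat.log 2 n) / 2 ^ Nat.log 2 n := by
  -- The extra `a 0` is the term `n = 0`, since `Nat.log 2 0 = 0`.
  have hsum : ∀ N : ℕ, ∑ n ∈ Finset.range (2 ^ N), a (Nat.log 2 n) / 2 ^ Nat.log 2 n =
      a 0 + ∑ m ∈ Finset.range N, a m := by
    intro N
    induction N with
    | zero => simp
    | succ N ih =>
      have hle : 2 ^ N ≤ 2 ^ (N + 1) := Nat.pow_le_pow_right two_pos N.le_succ
      rw [← Finset.sum_range_add_sum_Ico _ hle, ih, Finset.sum_range_succ, add_assoc]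
      congr 2
      have : ∀ n ∈ Finset.Ico (2 ^ N) (2 ^ (N + 1)),
          a (Nat.log 2 n) / 2 ^ Nat.log 2 n = a N / 2 ^ N := fun n hn => by
        rw [Finset.mem_Ico] at hn
        rw [Nat.log_eq_of_pow_le_of_lt_pow hn.1 hn.2]
      rw [Finset.sum_congr rfl this, Finset.sum_const, Nat.card_Ico,
        show 2 ^ (N + 1) - 2 ^ N = 2 ^ N by rw [pow_succ]; omega, nsmul_eq_mul]
      push_cast
      field_simp
  have hnn : ∀ n : ℕ, 0 ≤ a (Nat.log 2 n) / 2 ^ Nat.log 2 n := fun n =>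
    div_nonneg (ha0 _) (by positivity)
  refine summable_of_sum_range_le (c := a 0 + ∑' m, a m) hnn fun n => ?_
  calc _ ≤ ∑ n ∈ Finset.range (2 ^ n), a (Nat.log 2 n) / 2 ^ Nat.log 2 n :=
        Finset.sum_le_sum_of_subset_of_nonneg
          (Finset.range_subset_range.2 n.lt_two_pow_self.le) fun i _ _ => hnn i
    _ ≤ _ := by
        rw [hsum]
        gcongr
        exact ha.sum_le_tsum _ fun m _ => ha0 m

theorem exists_geometricLevels_tail {Ω' : Type*} [MeasurableSpace Ω'] {P' : Measure Ω'}
    [IsProbabilityMeasure P'] {p s x₀ α : ℝ} {L : ℝ → ℝ}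
    (h : GrowthBounds p s x₀ fun x => x * L x) (hLcont : ContinuousOn L (Ici 0))
    {Y : Ω' → ℝ} (hY : Measurable Y)
    (hmom : Integrable (fun ω => |Y ω| ^ p * L |Y ω| ^ p) P') (hα : 1 / p ≤ α) :
    ∃ w : ℕ → ℝ, (∀ m, x₀ ≤ w m) ∧
      (∀ m, w m * L (w m) = x₀ * L x₀ * ((2 : ℝ) ^ α) ^ m) ∧
      GeometricLevels (2 ^ (α * p)) (2 ^ (α / s)) w ∧
      Summable fun m => ((2 : ℝ) ^ (α * p)) ^ m * P'.real {ω | w m < |Y ω|} := by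
  have hp := h.one_le
  have hα0 : 0 < α := lt_of_lt_of_le (by positivity) hα
  have hf0 : 0 < x₀ * L x₀ := h.f_pos x₀ le_rfl
  obtain ⟨w, hw, hfw⟩ := h.exists_levels
    ((continuousOn_id.mul hLcont).mono (Ici_subset_Ici.2 h.pos.le))
    (Real.one_le_rpow one_le_two hα0.le : (1 : ℝ) ≤ 2 ^ α)
  have hlev := h.geometricLevels hα hw hfw
  refine ⟨w, hw, hfw, hlev, summable_pow_mul_tail hY hmom hlev.two_le
    (Real.rpow_pos_of_pos hf0 p) fun m ω hω => ?_⟩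
  have hy : x₀ ≤ |Y ω| := (hw m).trans hω.le
  have hlt := (h.strictMonoOn (hw m) hy hω).le
  simp only [hfw] at hlt
  have hy0 : 0 < |Y ω| := h.pos.trans_le hy
  have hLy : 0 < L |Y ω| := pos_of_mul_pos_right (h.f_pos _ hy) hy0.le
  refine le_trans ?_ (le_abs_self _)
  rw [← Real.mul_rpow hy0.le hLy.le]
  refine le_trans (le_of_eq ?_) (Real.rpow_le_rpow (by positivity) hlt (by linarith))
  rw [Real.mul_rpow hf0.le (by positivity), Real.rpow_mul (by norm_num),
    Real.rpow_pow_comm (by positivity)]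

theorem summable_of_dyadic {Ω : Type*} [MeasurableSpace Ω] {P : Measure Ω}
    [IsProbabilityMeasure P] {X : ℕ → Ω → ℝ} {κ ε c : ℝ} (hκ : 1 ≤ κ) (hε : 0 < ε) (hc : 0 < c)
    {w b : ℕ → ℝ}
    (hb : ∀ᶠ n : ℕ in atTop, w (Nat.log 2 n + 1) ≤ c * b n)
    (hsum : Summable fun m : ℕ => ((2 : ℝ) ^ κ / 2) ^ m *
      P.real {ω | ε / c * w m < maxCenteredSum P X (2 ^ m) ω}) :
    Summable fun n : ℕ => (n : ℝ) ^ (κ - 2) * P.real {ω | ε * b n < maxCenteredSum P X n ω} := by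
  have hlog := summable_div_two_pow_log ((summable_nat_add_iff 1).2 hsum)
    (fun m => by positivity)
  refine Summable.of_norm_bounded_eventually_nat hlog ?_
  filter_upwards [hb, eventually_ge_atTop 1] with n hn hn1
  rw [Real.norm_of_nonneg (by positivity)]
  set m := Nat.log 2 n with hm
  have hlo : 2 ^ m ≤ n := Nat.pow_log_le_self 2 (by omega)
  have hhi : n < 2 ^ (m + 1) := Nat.lt_pow_succ_log_self one_lt_two n
  have hlo' : (2 : ℝ) ^ m ≤ n := by exact_mod_cast hlo
  have hhi' : (n : ℝ) ≤ 2 ^ (m + 1) := by exact_mod_cast hhi.le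
  have hn0 : (0 : ℝ) < n := by exact_mod_cast hn1
  -- The exponent `κ - 2` may be negative, so `n ^ (κ - 2)` is split as `n ^ (κ - 1) / n` and the
  -- two factors are bounded at opposite ends of the dyadic range.
  have hpow : (n : ℝ) ^ (κ - 2) ≤ ((2 : ℝ) ^ κ / 2) ^ (m + 1) / 2 ^ m := by
    have e : (2 : ℝ) ^ κ / 2 = 2 ^ (κ - 1) := by
      rw [Real.rpow_sub two_pos, Real.rpow_one]
    rw [show κ - 2 = κ - 1 - 1 by ring, Real.rpow_sub hn0, Real.rpow_one, e,
      Real.rpow_pow_comm (by norm_num)]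
    gcongr
  have hset : {ω | ε * b n < maxCenteredSum P X n ω} ⊆
      {ω | ε / c * w (m + 1) < maxCenteredSum P X (2 ^ (m + 1)) ω} := by
    intro ω hω
    refine lt_of_le_of_lt ?_ (lt_of_lt_of_le hω (maxCenteredSum_monotone P X ω hhi.le))
    calc ε / c * w (m + 1) ≤ ε / c * (c * b n) := by gcongr
      _ = ε * b n := by field_simp
  calc _ ≤ ((2 : ℝ) ^ κ / 2) ^ (m + 1) / 2 ^ m *
        P.real {ω | ε / c * w (m + 1) < maxCenteredSum P X (2 ^ (m + 1)) ω} :=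
        mul_le_mul hpow (measureReal_mono hset) measureReal_nonneg (by positivity)
    _ = _ := by ring

/-- The values of `x * L x` at the two points are compared, via `n ^ α ≤ 2 * f (n ^ α * Lt (n ^ α))`
with `f x = x * L x`; the lower growth bound then transfers the comparison to the points. -/
theorem eventually_level_le {p s x₀ α : ℝ} {L Lt : ℝ → ℝ}
    (h : GrowthBounds p s x₀ fun x => x * L x) (hLcont : ContinuousOn L (Ici 0))
    (hLt : IsDeBruijnConjugate L Lt) (hα : 0 < α) {w : ℕ → ℝ}
    (hfw : ∀ m, w m * L (w m) = x₀ * L x₀ * ((2 : ℝ) ^ α) ^ m) :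
    ∃ c, 0 < c ∧ ∀ᶠ n : ℕ in atTop,
      w (Nat.log 2 n + 1) ≤ c * ((n : ℝ) ^ α * Lt ((n : ℝ) ^ α)) := by
  have hf0 : 0 < x₀ * L x₀ := h.f_pos x₀ le_rfl
  refine ⟨max 1 ((2 * (x₀ * L x₀) * 2 ^ α) ^ p), lt_max_of_lt_left one_pos, ?_⟩
  have hnα : Tendsto (fun n : ℕ => (n : ℝ) ^ α) atTop atTop :=
    (tendsto_rpow_atTop hα).comp tendsto_natCast_atTop_atTop
  filter_upwards [hnα.eventually ((tendsto_mul_deBruijnConjugate hLcont hLt).eventually_ge_atTop x₀),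
    hnα.eventually (eventually_le_two_mul_deBruijn hLt), eventually_ge_atTop 1] with n h1 h2 hn
  refine h.le_of_le_mul h1 ?_
  have hlo : (2 : ℝ) ^ Nat.log 2 n ≤ n := by exact_mod_cast Nat.pow_log_le_self 2 (by omega)
  have h3 : ((2 : ℝ) ^ α) ^ Nat.log 2 n ≤ (n : ℝ) ^ α := by
    rw [Real.rpow_pow_comm (by norm_num)]
    exact Real.rpow_le_rpow (by positivity) hlo hα.le
  simp only [hfw]
  calc x₀ * L x₀ * ((2 : ℝ) ^ α) ^ (Nat.log 2 n + 1)
      = x₀ * L x₀ * 2 ^ α * ((2 : ℝ) ^ α) ^ Nat.log 2 n := by ring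
    _ ≤ x₀ * L x₀ * 2 ^ α * (2 * ((n : ℝ) ^ α * Lt ((n : ℝ) ^ α) *
          L ((n : ℝ) ^ α * Lt ((n : ℝ) ^ α)))) := by gcongr; exact h3.trans h2
    _ = _ := by ring

theorem mainTheorem1 {Ω Ω' : Type*} [MeasurableSpace Ω] [MeasurableSpace Ω']
    (P : Measure Ω) [IsProbabilityMeasure P] (P' : Measure Ω') [IsProbabilityMeasure P']
    (p : ℝ) (hp1 : 1 ≤ p) (hp2 : p < 2)
    (X : ℕ → Ω → ℝ) (hX : ∀ n, 1 ≤ n → Measurable (X n))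
    (hvar : VarianceInequality P X)
    (L : ℝ → ℝ) (hL : IsSlowlyVarying L)
    (hLcont : ContinuousOn L (Ici 0))
    (hLdiff : ∃ A : ℝ, 0 < A ∧ DifferentiableOn ℝ L (Ici A))
    (hLderiv : Tendsto (fun x => x * deriv L x / L x) atTop (𝓝 0))
    (hLone : p = 1 → (∀ x, 0 ≤ x → 1 ≤ L x) ∧ MonotoneOn L (Ici 0))
    (Lt : ℝ → ℝ) (hLt : IsDeBruijnConjugate L Lt)
    (Y : Ω' → ℝ) (hY : Measurable Y)
    (hdom : StochasticallyDominated P X P' Y)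
    (hmom : Integrable (fun ω => |Y ω| ^ p * L |Y ω| ^ p) P') :
    (∀ n, 1 ≤ n → Integrable (X n) P) ∧
      ∀ α : ℝ, 1 / p ≤ α → ∀ ε : ℝ, 0 < ε →
        Summable fun n : ℕ => (n : ℝ) ^ (α * p - 2) *
          P.real {ω | ε * (n : ℝ) ^ α * Lt ((n : ℝ) ^ α) < maxCenteredSum P X n ω} := by
  obtain ⟨s, hs1, hsp⟩ : ∃ s, 1 < s ∧ s * p < 2 := by
    obtain ⟨s, h1, h2⟩ := exists_between ((one_lt_div (by linarith)).2 hp2)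
    exact ⟨s, h1, (lt_div_iff₀ (by linarith)).1 h2⟩
  obtain ⟨x₀, hx₀, hLpos, hgrowth⟩ := exists_growth_bounds hp1 hs1 hL hLdiff hLderiv hLone
  have h : GrowthBounds p s x₀ fun x => x * L x :=
    ⟨hx₀, hp1, hs1, hsp, fun x hx => mul_pos (hx₀.trans_le hx) (hLpos x hx),
      fun x y hx hxy => (hgrowth x y hx hxy).1, fun x y hx hxy => (hgrowth x y hx hxy).2⟩
  have htail : ∀ a, 0 ≤ a → ∀ n, 1 ≤ n → P.real {ω | a < |X n ω|} ≤ P'.real {ω | a < |Y ω|} :=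
    fun a ha n hn => ENNReal.toReal_mono (measure_ne_top _ _) (hdom a ha n hn)
  refine ⟨fun n hn => ?_, fun α hα ε hε => ?_⟩
  -- Integrability does not involve `α`; the smallest value `α = 1 / p`, for which `q = 2`,
  -- suffices.
  · obtain ⟨w, hw, -, hlev, hsum⟩ := exists_geometricLevels_tail h hLcont hY hmom le_rfl
    exact integrable_of_tail_levels hlev (hX n hn)
      (fun l => htail _ (hlev.pos l).le n hn) hsum
  · obtain ⟨w, hw, hfw, hlev, hsum⟩ := exists_geometricLevels_tail h hLcont hY hmom hα
    have hα0 : 0 < α := lt_of_lt_of_le (by positivity) hα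
    obtain ⟨c, hc, hle⟩ := eventually_level_le h hLcont hLt hα0 hfw
    have := summable_of_dyadic (P := P) (X := X) (κ := α * p)
      (by rwa [div_le_iff₀ (by positivity)] at hα) hε hc hle
      (summable_dyadic hlev hvar hX (fun n hn l => htail _ (hlev.pos l).le n hn) hsum
        (div_pos hε hc))
    simpa only [mul_assoc] using this
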